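/- Let $X$ be the complex Hilbert space of all $(u,v,w,\tilde u,\tilde v)\in H^1(0,1)\times L^2(0,1)\times L^2(1,2)\times H^1(2,3)\times L^2(2,3)$ with $u(0)=\tilde u(3)=0$, with the norm $$\|(u,v,w,\tilde u,\tilde v)\|_X^2=\|u'\|_{L^2}^2+\|v\|_{L^2}^2+\|w\|_{L^2}^2+\|\tilde u'\|_{L^2}^2+\|\tilde v\|_{L^2}^2 .$$ Let $A$ be the operator $A(u,v,w,\tilde u,\tilde v)=(v,u'',w'',\tilde v,\tilde u'')$ on $X$ whose domain $D(A)$ consists of all $(u,v,w,\tilde u,\tilde v)\in X$ with $u\in H^2(0,1)$, $v\in H^1(0,1)$, $w\in H^2(1,2)$, $\tilde u\in H^2(2,3)$, $\tilde v\in H^1(2,3)$ and $$v(0)=\tilde v(3)=0,\quad u'(1)=w'(1),\quad v(1)=w(1),\quad \tilde u'(2)=w'(2),\quad \tilde v(2)=w(2).$$ For $\lambda\in\mathbb C$ let $\sqrt\lambda$ be the principal square root ($\sqrt{re^{i\theta}}=r^{1/2}e^{i\theta/2}$ for $r\ge 0$, $\theta\in(-\pi,\pi]$), and put $$M_\lambda=\begin{pmatrix}\lambda\sinh\lambda&-1&0&0\\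 \lambda\cosh\lambda&0&-\sqrt\lambda&0\\ 0&-\cosh\sqrt\lambda&-\sinh\sqrt\lambda&\lambda\sinh\lambda\\ 0&\sqrt\lambda\sinh\sqrt\lambda&\sqrt\lambda\cosh\sqrt\lambda&\lambda\cosh\lambda\end{pmatrix}.$$ **Theorem.** Every point of the spectrum $\sigma(A)$ is an eigenvalue of $A$ and an isolated point of $\sigma(A)$, and $$\sigma(A)=\{\lambda\in\mathbb C:\ \operatorname{Re}\lambda<0,\ \det M_\lambda=0\}.$$ In particular, $\sigma(A)\cap i\mathbb R=\emptyset$. -/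

import Mathlib

open MeasureTheory Set Topology
open scoped ContDiff ComplexConjugate

noncomputable section

namespace WaveHeatWave

/-! Function spaces on a bounded interval -/

/-- The complex Hilbert space `L²(a,b)`. -/
abbrev L2 (a b : ℝ) : Type := Lp ℂ 2 (volume.restrict (Ioo a b))

/-- `φ ∈ C_c^∞(a,b)`. -/
def IsTest (a b : ℝ) (φ : ℝ → ℝ) : Prop :=
  ContDiff ℝ ∞ φ ∧ HasCompactSupport φ ∧ tsupport φ ⊆ Ioo a b

/-- `g ∈ L²(a,b)` is the weak derivative of `f ∈ L²(a,b)`. -/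
def IsWeakDeriv {a b : ℝ} (f g : L2 a b) : Prop :=
  ∀ φ : ℝ → ℝ, IsTest a b φ →
    ∫ x in Ioo a b, deriv φ x • f x = - ∫ x in Ioo a b, φ x • g x

lemma IsTest.integrable_smul {a b : ℝ} {φ : ℝ → ℝ} (hφ : Continuous φ)
    (hc : HasCompactSupport φ) (f : L2 a b) :
    Integrable (fun x => φ x • f x) (volume.restrict (Ioo a b)) := by
  have hf : Integrable f (volume.restrict (Ioo a b)) :=
    (Lp.memLp f).integrable (by norm_num)
  obtain ⟨C, hC⟩ := hφ.bounded_above_of_compact_support hc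
  exact hf.bdd_smul C hφ.aestronglyMeasurable (Filter.Eventually.of_forall hC)

lemma IsTest.integrable_deriv_smul {a b : ℝ} {φ : ℝ → ℝ} (hφ : IsTest a b φ) (f : L2 a b) :
    Integrable (fun x => deriv φ x • f x) (volume.restrict (Ioo a b)) :=
  IsTest.integrable_smul (hφ.1.continuous_deriv (by simp)) hφ.2.1.deriv f

lemma IsWeakDeriv.add {a b : ℝ} {f₁ f₂ g₁ g₂ : L2 a b} (h₁ : IsWeakDeriv f₁ g₁)
    (h₂ : IsWeakDeriv f₂ g₂) : IsWeakDeriv (f₁ + f₂) (g₁ + g₂) := by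
  intro φ hφ
  have e₁ : ∫ x in Ioo a b, deriv φ x • (f₁ + f₂ : L2 a b) x
      = ∫ x in Ioo a b, (deriv φ x • f₁ x + deriv φ x • f₂ x) := by
    refine integral_congr_ae ?_
    filter_upwards [Lp.coeFn_add f₁ f₂] with x hx
    rw [hx, Pi.add_apply, smul_add]
  have e₂ : ∫ x in Ioo a b, φ x • (g₁ + g₂ : L2 a b) x
      = ∫ x in Ioo a b, (φ x • g₁ x + φ x • g₂ x) := by
    refine integral_congr_ae ?_
    filter_upwards [Lp.coeFn_add g₁ g₂] with x hx
    rw [hx, Pi.add_apply, smul_add]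
  rw [e₁, e₂, integral_add (hφ.integrable_deriv_smul f₁) (hφ.integrable_deriv_smul f₂),
    integral_add (IsTest.integrable_smul hφ.1.continuous hφ.2.1 g₁)
      (IsTest.integrable_smul hφ.1.continuous hφ.2.1 g₂), h₁ φ hφ, h₂ φ hφ]
  ring

lemma IsWeakDeriv.smul {a b : ℝ} {f g : L2 a b} (c : ℂ) (h : IsWeakDeriv f g) :
    IsWeakDeriv (c • f) (c • g) := by
  intro φ hφ
  have e₁ : ∫ x in Ioo a b, deriv φ x • (c • f : L2 a b) x
      = ∫ x in Ioo a b, c • (deriv φ x • f x) := by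
    refine integral_congr_ae ?_
    filter_upwards [Lp.coeFn_smul c f] with x hx
    rw [hx, Pi.smul_apply, smul_comm]
  have e₂ : ∫ x in Ioo a b, φ x • (c • g : L2 a b) x
      = ∫ x in Ioo a b, c • (φ x • g x) := by
    refine integral_congr_ae ?_
    filter_upwards [Lp.coeFn_smul c g] with x hx
    rw [hx, Pi.smul_apply, smul_comm]
  rw [e₁, e₂, integral_smul, integral_smul, h φ hφ, smul_neg]

lemma IsWeakDeriv.zero {a b : ℝ} : IsWeakDeriv (0 : L2 a b) 0 := by
  intro φ _
  have e : ∀ ψ : ℝ → ℝ, ∫ x in Ioo a b, ψ x • (0 : L2 a b) x = 0 := by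
    intro ψ
    rw [← integral_zero ℝ ℂ (μ := volume.restrict (Ioo a b))]
    refine integral_congr_ae ?_
    filter_upwards [Lp.coeFn_zero ℂ 2 (volume.restrict (Ioo a b))] with x hx
    rw [hx, Pi.zero_apply, smul_zero]
  rw [e, e, neg_zero]

/-- Fundamental lemma of the calculus of variations on `(a,b)`. -/
lemma ae_zero_of_test {a b : ℝ} {f : ℝ → ℂ} (hf : Integrable f (volume.restrict (Ioo a b)))
    (h : ∀ φ : ℝ → ℝ, IsTest a b φ → ∫ x in Ioo a b, φ x • f x = 0) :
    f =ᵐ[volume.restrict (Ioo a b)] 0 := by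
  have hI : IntegrableOn f (Ioo a b) := hf
  have := isOpen_Ioo.ae_eq_zero_of_integral_contDiff_smul_eq_zero
    (μ := volume) (U := Ioo a b) hI.locallyIntegrableOn (fun φ h1 h2 h3 => by
      rw [← h φ ⟨h1, h2, h3⟩]
      refine (setIntegral_eq_integral_of_forall_compl_eq_zero fun x hx => ?_).symm
      rw [image_eq_zero_of_notMem_tsupport (fun hx' => hx (h3 hx')), zero_smul])
  exact (ae_restrict_iff' measurableSet_Ioo).2 this

lemma IsWeakDeriv.unique {a b : ℝ} {f g₁ g₂ : L2 a b} (h₁ : IsWeakDeriv f g₁)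
    (h₂ : IsWeakDeriv f g₂) : g₁ = g₂ := by
  have hi : ∀ g : L2 a b, Integrable g (volume.restrict (Ioo a b)) := fun g =>
    (Lp.memLp g).integrable (by norm_num)
  have key : (fun x => g₁ x - g₂ x) =ᵐ[volume.restrict (Ioo a b)] 0 := by
    refine ae_zero_of_test ((hi g₁).sub (hi g₂)) fun φ hφ => ?_
    simp only [smul_sub]
    rw [integral_sub (IsTest.integrable_smul hφ.1.continuous hφ.2.1 g₁)
      (IsTest.integrable_smul hφ.1.continuous hφ.2.1 g₂), sub_eq_zero]
    exact neg_injective ((h₁ φ hφ).symm.trans (h₂ φ hφ))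
  refine Lp.ext ?_
  filter_upwards [key] with x hx
  exact sub_eq_zero.1 hx

/-- The Sobolev space `H¹(a,b)`. -/
def H1 (a b : ℝ) : Submodule ℂ (L2 a b) where
  carrier := {f | ∃ g : L2 a b, IsWeakDeriv f g}
  zero_mem' := ⟨0, IsWeakDeriv.zero⟩
  add_mem' := fun ⟨g₁, h₁⟩ ⟨g₂, h₂⟩ => ⟨g₁ + g₂, h₁.add h₂⟩
  smul_mem' := fun c _ ⟨g, h⟩ => ⟨c • g, h.smul c⟩

open Classical in
/-- The weak derivative `f'` of `f ∈ H¹(a,b)` (and `0` if `f ∉ H¹(a,b)`). -/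
def wd {a b : ℝ} (f : L2 a b) : L2 a b :=
  if h : ∃ g : L2 a b, IsWeakDeriv f g then h.choose else 0

lemma isWeakDeriv_wd {a b : ℝ} {f : L2 a b} (hf : f ∈ H1 a b) : IsWeakDeriv f (wd f) := by
  have h : ∃ g : L2 a b, IsWeakDeriv f g := hf
  rw [wd, dif_pos h]
  exact h.choose_spec

lemma IsWeakDeriv.wd_eq {a b : ℝ} {f g : L2 a b} (h : IsWeakDeriv f g) : wd f = g :=
  (isWeakDeriv_wd ⟨g, h⟩).unique h

lemma wd_add {a b : ℝ} {f g : L2 a b} (hf : f ∈ H1 a b) (hg : g ∈ H1 a b) :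
    wd (f + g) = wd f + wd g :=
  ((isWeakDeriv_wd hf).add (isWeakDeriv_wd hg)).wd_eq

lemma wd_smul {a b : ℝ} {f : L2 a b} (c : ℂ) (hf : f ∈ H1 a b) :
    wd (c • f) = c • wd f :=
  ((isWeakDeriv_wd hf).smul c).wd_eq

lemma wd_zero {a b : ℝ} : wd (0 : L2 a b) = 0 := IsWeakDeriv.zero.wd_eq

/-- The Sobolev space `H²(a,b)`. -/
def H2 (a b : ℝ) : Submodule ℂ (L2 a b) where
  carrier := {f | f ∈ H1 a b ∧ wd f ∈ H1 a b}
  zero_mem' := ⟨zero_mem _, by rw [wd_zero]; exact zero_mem _⟩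
  add_mem' := fun hf hg => ⟨add_mem hf.1 hg.1, by
    rw [wd_add hf.1 hg.1]; exact add_mem hf.2 hg.2⟩
  smul_mem' := fun c _ hf => ⟨Submodule.smul_mem _ c hf.1, by
    rw [wd_smul c hf.1]; exact Submodule.smul_mem _ c hf.2⟩

lemma wd_wd_add {a b : ℝ} {f g : L2 a b} (hf : f ∈ H2 a b) (hg : g ∈ H2 a b) :
    wd (wd (f + g)) = wd (wd f) + wd (wd g) := by
  rw [wd_add hf.1 hg.1, wd_add hf.2 hg.2]

lemma wd_wd_smul {a b : ℝ} {f : L2 a b} (c : ℂ) (hf : f ∈ H2 a b) :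
    wd (wd (c • f)) = c • wd (wd f) := by
  rw [wd_smul c hf.1, wd_smul c hf.2]

/-- `f(p) = z` for `p ∈ [a,b]`: the representative of `f` that is continuous on `[a,b]`
takes the value `z` at `p`. (Every `f ∈ H¹(a,b)` has exactly one such representative.) -/
def HasValue {a b : ℝ} (f : L2 a b) (p : ℝ) (z : ℂ) : Prop :=
  ∃ c : ℝ → ℂ, ContinuousOn c (Icc a b) ∧ f =ᵐ[volume.restrict (Ioo a b)] c ∧ c p = z

/-- `f(p) = g(p)` for functions on two intervals with `p` in the closure of both. -/
def SameValue {a b a' b' : ℝ} (f : L2 a b) (g : L2 a' b') (p : ℝ) : Prop :=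
  ∃ z : ℂ, HasValue f p z ∧ HasValue g p z

lemma HasValue.zero {a b p : ℝ} : HasValue (0 : L2 a b) p 0 :=
  ⟨0, continuousOn_const, Lp.coeFn_zero _ _ _, rfl⟩

lemma HasValue.add {a b p : ℝ} {f g : L2 a b} {z w : ℂ} (hf : HasValue f p z)
    (hg : HasValue g p w) : HasValue (f + g) p (z + w) := by
  obtain ⟨c, hc, hfc, rfl⟩ := hf
  obtain ⟨d, hd, hgd, rfl⟩ := hg
  exact ⟨c + d, hc.add hd, (Lp.coeFn_add f g).trans (hfc.add hgd), rfl⟩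

lemma HasValue.smul {a b p : ℝ} {f : L2 a b} {z : ℂ} (k : ℂ) (hf : HasValue f p z) :
    HasValue (k • f) p (k * z) := by
  obtain ⟨c, hc, hfc, rfl⟩ := hf
  exact ⟨k • c, hc.const_smul k, (Lp.coeFn_smul k f).trans (hfc.const_smul k), rfl⟩

lemma HasValue.add_zero {a b p : ℝ} {f g : L2 a b} (hf : HasValue f p 0)
    (hg : HasValue g p 0) : HasValue (f + g) p 0 := by
  simpa using hf.add hg

lemma HasValue.smul_zero {a b p : ℝ} {f : L2 a b} (k : ℂ) (hf : HasValue f p 0) :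
    HasValue (k • f) p 0 := by
  simpa using hf.smul k

lemma SameValue.zero {a b a' b' p : ℝ} : SameValue (0 : L2 a b) (0 : L2 a' b') p :=
  ⟨0, HasValue.zero, HasValue.zero⟩

lemma SameValue.add {a b a' b' p : ℝ} {f₁ f₂ : L2 a b} {g₁ g₂ : L2 a' b'}
    (h₁ : SameValue f₁ g₁ p) (h₂ : SameValue f₂ g₂ p) :
    SameValue (f₁ + f₂) (g₁ + g₂) p := by
  obtain ⟨z, hz, hz'⟩ := h₁
  obtain ⟨w, hw, hw'⟩ := h₂
  exact ⟨z + w, hz.add hw, hz'.add hw'⟩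

lemma SameValue.smul {a b a' b' p : ℝ} {f : L2 a b} {g : L2 a' b'} (k : ℂ)
    (h : SameValue f g p) : SameValue (k • f) (k • g) p := by
  obtain ⟨z, hz, hz'⟩ := h
  exact ⟨k * z, hz.smul k, hz'.smul k⟩

/-- A function whose weak derivative vanishes is almost everywhere constant. -/
lemma ae_const_of_weakDeriv_zero {a b : ℝ} (hab : a < b) {f : L2 a b}
    (hf : IsWeakDeriv f 0) :
    ∃ c : ℂ, f =ᵐ[volume.restrict (Ioo a b)] fun _ => c := by
  have hi : Integrable f (volume.restrict (Ioo a b)) :=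
    (Lp.memLp f).integrable (by norm_num)
  have hr : ∃ ρ : ℝ → ℝ, IsTest a b ρ ∧ ∫ x, ρ x = 1 := by
    let B : ContDiffBump ((a + b) / 2) := ⟨(b - a) / 4, (b - a) / 3, by linarith, by linarith⟩
    refine ⟨B.normed volume, ⟨B.contDiff_normed, B.hasCompactSupport_normed, ?_⟩,
      B.integral_normed⟩
    rw [B.tsupport_normed_eq, Real.closedBall_eq_Icc]
    intro x hx
    have h1 : (a + b) / 2 - (b - a) / 3 ≤ x := hx.1
    have h2 : x ≤ (a + b) / 2 + (b - a) / 3 := hx.2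
    constructor <;> linarith
  obtain ⟨ρ, hρ, hρ1⟩ := hr
  have hprim : ∀ ψ : ℝ → ℝ, IsTest a b ψ → ∫ x, ψ x = 0 →
      ∫ x in Ioo a b, ψ x • f x = 0 := by
    intro ψ hψ h0
    have hcont : Continuous ψ := hψ.1.continuous
    let Φ : ℝ → ℝ := fun x => ∫ t in a..x, ψ t
    have hd : ∀ x, HasDerivAt Φ (ψ x) x := fun x => hcont.integral_hasStrictDerivAt a x |>.hasDerivAt
    have hderiv : deriv Φ = ψ := funext fun x => (hd x).deriv
    have hsub : ∃ a' b', a < a' ∧ b' < b ∧ ∀ x, x ∉ Icc a' b' → ψ x = 0 := by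
      rcases (tsupport ψ).eq_empty_or_nonempty with he | hne
      · refine ⟨b, a, hab, hab, fun x _ => image_eq_zero_of_notMem_tsupport ?_⟩
        rw [he]; exact notMem_empty x
      · have hK : IsCompact (tsupport ψ) := hψ.2.1
        obtain ⟨p, hp, hp'⟩ := hK.exists_isLeast hne
        obtain ⟨q, hq, hq'⟩ := hK.exists_isGreatest hne
        exact ⟨p, q, (hψ.2.2 hp).1, (hψ.2.2 hq).2, fun x hx =>
          image_eq_zero_of_notMem_tsupport fun hx' => hx ⟨hp' hx', hq' hx'⟩⟩
    obtain ⟨a', b', ha', hb', hz⟩ := hsub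
    have hΦ0 : ∀ x, x ∉ Icc a' b' → Φ x = 0 := by
      intro x hx
      by_cases hxa : x < a'
      · have : ∀ t ∈ uIcc a x, ψ t = 0 := by
          intro t ht
          refine hz t fun h => ?_
          have : t ≤ max a x := ht.2
          exact absurd h.1 (not_le.2 (this.trans_lt (max_lt ha' hxa)))
        change ∫ t in a..x, ψ t = 0
        rw [intervalIntegral.integral_congr (g := fun _ => (0 : ℝ)) this]
        simp
      · have hxb : b' < x := by
          by_contra hcon
          exact hx ⟨not_lt.1 hxa, not_lt.1 hcon⟩
        change ∫ t in a..x, ψ t = 0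
        rw [intervalIntegral.integral_eq_integral_of_support_subset, h0]
        intro t ht
        have hmem : t ∈ Icc a' b' := by
          by_contra hcon
          exact ht (hz t hcon)
        exact ⟨ha'.trans_le hmem.1, hmem.2.trans hxb.le⟩
    have htest : IsTest a b Φ := by
      have hts : tsupport Φ ⊆ Icc a' b' := by
        refine closure_minimal (fun x hx => ?_) isClosed_Icc
        by_contra hcon
        exact hx (hΦ0 x hcon)
      refine ⟨?_, ?_, hts.trans fun x hx => ⟨ha'.trans_le hx.1, hx.2.trans_lt hb'⟩⟩
      · rw [contDiff_infty_iff_deriv, hderiv]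
        exact ⟨fun x => (hd x).differentiableAt, hψ.1⟩
      · exact isCompact_Icc.of_isClosed_subset (isClosed_tsupport _) hts
    have := hf Φ htest
    rw [hderiv] at this
    rw [this, neg_eq_zero, ← integral_zero ℝ ℂ (μ := volume.restrict (Ioo a b))]
    refine integral_congr_ae ?_
    filter_upwards [Lp.coeFn_zero ℂ 2 (volume.restrict (Ioo a b))] with x hx
    rw [hx, Pi.zero_apply, smul_zero]
  set c : ℂ := ∫ x in Ioo a b, ρ x • f x with hc
  refine ⟨c, ?_⟩
  have key : (fun x => f x - c) =ᵐ[volume.restrict (Ioo a b)] 0 := by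
    refine ae_zero_of_test (hi.sub (integrable_const c)) fun φ hφ => ?_
    have hφi : Integrable φ := hφ.1.continuous.integrable_of_hasCompactSupport hφ.2.1
    have hρi : Integrable ρ := hρ.1.continuous.integrable_of_hasCompactSupport hρ.2.1
    set m : ℝ := ∫ x, φ x with hm
    have ht : IsTest a b (fun x => φ x - m * ρ x) := by
      have hsub : tsupport (fun x => φ x - m * ρ x) ⊆ tsupport φ ∪ tsupport ρ := by
        refine closure_minimal (fun x hx => ?_)
          ((isClosed_tsupport φ).union (isClosed_tsupport ρ))
        by_contra hcon
        rw [mem_union, not_or] at hcon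
        exact hx (by simp [image_eq_zero_of_notMem_tsupport hcon.1,
          image_eq_zero_of_notMem_tsupport hcon.2])
      refine ⟨hφ.1.sub (contDiff_const.mul hρ.1), ?_, hsub.trans (union_subset hφ.2.2 hρ.2.2)⟩
      exact (hφ.2.1.isCompact.union hρ.2.1.isCompact).of_isClosed_subset (isClosed_tsupport _) hsub
    have h0 := hprim _ ht (by
      rw [integral_sub hφi (hρi.const_mul m), integral_const_mul, hρ1, mul_one, sub_self])
    have I1 := IsTest.integrable_smul hφ.1.continuous hφ.2.1 f
    have I2 := IsTest.integrable_smul hρ.1.continuous hρ.2.1 f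
    have h1 : ∫ x in Ioo a b, φ x • f x = m • c := by
      have e : ∀ x, (φ x - m * ρ x) • f x = φ x • f x - m • (ρ x • f x) := fun x => by
        rw [sub_smul, mul_smul]
      simp only [e] at h0
      have I3 : Integrable (fun x => m • (ρ x • f x)) (volume.restrict (Ioo a b)) := I2.smul m
      rw [integral_sub I1 I3, integral_smul, sub_eq_zero] at h0
      exact h0
    have hm' : ∫ x in Ioo a b, φ x = m := by
      refine setIntegral_eq_integral_of_forall_compl_eq_zero fun x hx => ?_
      exact image_eq_zero_of_notMem_tsupport fun hx' => hx (hφ.2.2 hx')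
    simp only [smul_sub]
    rw [integral_sub I1 (hφi.restrict.smul_const c), h1, integral_smul_const, hm', sub_self]
  filter_upwards [key] with x hx
  exact sub_eq_zero.1 hx

/-- `f ∈ H¹(a,b)`, `f' = 0` and `f(p) = 0` for some `p ∈ [a,b]` force `f = 0`. -/
lemma eq_zero_of_wd_eq_zero {a b p : ℝ} (hab : a < b) (hp : p ∈ Icc a b) {f : L2 a b}
    (hf : f ∈ H1 a b) (h0 : wd f = 0) (hv : HasValue f p 0) : f = 0 := by
  have hw := isWeakDeriv_wd hf
  rw [h0] at hw
  obtain ⟨k, hk⟩ := ae_const_of_weakDeriv_zero hab hw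
  obtain ⟨c, hc, hfc, hcp⟩ := hv
  have hck : c =ᵐ[volume.restrict (Ioo a b)] fun _ => k := hfc.symm.trans hk
  have hck' : c =ᵐ[volume.restrict (Icc a b)] fun _ => k := by
    rwa [← restrict_Ioo_eq_restrict_Icc]
  have heq : EqOn c (fun _ => k) (Icc a b) :=
    Measure.eqOn_Icc_of_ae_eq volume hab.ne hck' hc continuousOn_const
  have hk0 : k = 0 := (heq hp).symm.trans hcp
  refine Lp.ext ?_
  filter_upwards [hk, Lp.coeFn_zero ℂ 2 (volume.restrict (Ioo a b))] with x h1 h2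
  rw [h1, h2, hk0, Pi.zero_apply]

/-! The state space `X` -/

/-- The vector space of all `(u, v, w, ũ, ṽ)` in
`H¹(0,1) × L²(0,1) × L²(1,2) × H¹(2,3) × L²(2,3)` with `u(0) = ũ(3) = 0`. -/
def stateSubmodule : Submodule ℂ (L2 0 1 × L2 0 1 × L2 1 2 × L2 2 3 × L2 2 3) where
  carrier := {x | x.1 ∈ H1 0 1 ∧ x.2.2.2.1 ∈ H1 2 3 ∧
    HasValue x.1 0 0 ∧ HasValue x.2.2.2.1 3 0}
  zero_mem' := ⟨zero_mem _, zero_mem _, HasValue.zero, HasValue.zero⟩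
  add_mem' := fun ⟨h1, h2, h3, h4⟩ ⟨k1, k2, k3, k4⟩ =>
    ⟨add_mem h1 k1, add_mem h2 k2, h3.add_zero k3, h4.add_zero k4⟩
  smul_mem' := fun c _ ⟨h1, h2, h3, h4⟩ =>
    ⟨Submodule.smul_mem _ c h1, Submodule.smul_mem _ c h2, h3.smul_zero c, h4.smul_zero c⟩

/-- The space `X`. It is a type of its own so that it carries only the energy norm below and
not the norm of the product. -/
def X : Type := stateSubmodule

instance : AddCommGroup X := inferInstanceAs (AddCommGroup stateSubmodule)

instance : Module ℂ X := inferInstanceAs (Module ℂ stateSubmodule)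

namespace X

/-- The component `u ∈ H¹(0,1)`. -/
def u (x : X) : L2 0 1 := x.1.1

/-- The component `v ∈ L²(0,1)`. -/
def v (x : X) : L2 0 1 := x.1.2.1

/-- The component `w ∈ L²(1,2)`. -/
def w (x : X) : L2 1 2 := x.1.2.2.1

/-- The component `ũ ∈ H¹(2,3)`. -/
def ut (x : X) : L2 2 3 := x.1.2.2.2.1

/-- The component `ṽ ∈ L²(2,3)`. -/
def vt (x : X) : L2 2 3 := x.1.2.2.2.2

lemma u_mem (x : X) : x.u ∈ H1 0 1 := x.2.1
lemma ut_mem (x : X) : x.ut ∈ H1 2 3 := x.2.2.1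
lemma u_zero (x : X) : HasValue x.u 0 0 := x.2.2.2.1
lemma ut_three (x : X) : HasValue x.ut 3 0 := x.2.2.2.2

@[ext] lemma ext {x y : X} (h1 : x.u = y.u) (h2 : x.v = y.v) (h3 : x.w = y.w)
    (h4 : x.ut = y.ut) (h5 : x.vt = y.vt) : x = y :=
  Subtype.ext (Prod.ext h1 (Prod.ext h2 (Prod.ext h3 (Prod.ext h4 h5))))

@[simp] lemma add_u (x y : X) : (x + y).u = x.u + y.u := rfl
@[simp] lemma add_v (x y : X) : (x + y).v = x.v + y.v := rfl
@[simp] lemma add_w (x y : X) : (x + y).w = x.w + y.w := rfl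
@[simp] lemma add_ut (x y : X) : (x + y).ut = x.ut + y.ut := rfl
@[simp] lemma add_vt (x y : X) : (x + y).vt = x.vt + y.vt := rfl
@[simp] lemma smul_u (c : ℂ) (x : X) : (c • x).u = c • x.u := rfl
@[simp] lemma smul_v (c : ℂ) (x : X) : (c • x).v = c • x.v := rfl
@[simp] lemma smul_w (c : ℂ) (x : X) : (c • x).w = c • x.w := rfl
@[simp] lemma smul_ut (c : ℂ) (x : X) : (c • x).ut = c • x.ut := rfl
@[simp] lemma smul_vt (c : ℂ) (x : X) : (c • x).vt = c • x.vt := rfl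
@[simp] lemma zero_u : (0 : X).u = 0 := rfl
@[simp] lemma zero_v : (0 : X).v = 0 := rfl
@[simp] lemma zero_w : (0 : X).w = 0 := rfl
@[simp] lemma zero_ut : (0 : X).ut = 0 := rfl
@[simp] lemma zero_vt : (0 : X).vt = 0 := rfl

lemma wd_add_u (x y : X) : wd (x.u + y.u) = wd x.u + wd y.u := wd_add x.u_mem y.u_mem
lemma wd_add_ut (x y : X) : wd (x.ut + y.ut) = wd x.ut + wd y.ut := wd_add x.ut_mem y.ut_mem
lemma wd_smul_u (c : ℂ) (x : X) : wd (c • x.u) = c • wd x.u := wd_smul c x.u_mem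
lemma wd_smul_ut (c : ℂ) (x : X) : wd (c • x.ut) = c • wd x.ut := wd_smul c x.ut_mem

/-- The energy inner product
`⟨x, y⟩ = ⟨u', p'⟩ + ⟨v, q⟩ + ⟨w, r⟩ + ⟨ũ', p̃'⟩ + ⟨ṽ, q̃⟩`
(conjugate-linear in the first argument, as everywhere in Mathlib). -/
def innerX (x y : X) : ℂ :=
  inner ℂ (wd x.u) (wd y.u) + inner ℂ x.v y.v + inner ℂ x.w y.w
    + inner ℂ (wd x.ut) (wd y.ut) + inner ℂ x.vt y.vt

lemma re_innerX_self (x : X) : (innerX x x).re =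
    ‖wd x.u‖ ^ 2 + ‖x.v‖ ^ 2 + ‖x.w‖ ^ 2 + ‖wd x.ut‖ ^ 2 + ‖x.vt‖ ^ 2 := by
  simp only [innerX, Complex.add_re]
  have h : ∀ {a b : ℝ} (f : L2 a b), (inner ℂ f f).re = ‖f‖ ^ 2 := fun f =>
    inner_self_eq_norm_sq (𝕜 := ℂ) f
  simp only [h]

/-- `innerX` is a (positive definite) inner product on `X`. -/
@[reducible] def core : InnerProductSpace.Core ℂ X where
  inner := innerX
  conj_inner_symm x y := by
    simp only [innerX, map_add, inner_conj_symm]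
  re_inner_nonneg x := by
    change 0 ≤ (innerX x x).re
    rw [re_innerX_self]; positivity
  add_left x y z := by
    simp only [innerX, add_u, add_v, add_w, add_ut, add_vt, wd_add_u, wd_add_ut, inner_add_left]
    ring
  smul_left x y c := by
    simp only [innerX, smul_u, smul_v, smul_w, smul_ut, smul_vt, wd_smul_u, wd_smul_ut,
      inner_smul_left]
    ring
  definite x hx := by
    have h := re_innerX_self x
    have hx' : innerX x x = 0 := hx
    rw [hx', Complex.zero_re] at h
    have p1 := sq_nonneg ‖wd x.u‖
    have p2 := sq_nonneg ‖x.v‖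
    have p3 := sq_nonneg ‖x.w‖
    have p4 := sq_nonneg ‖wd x.ut‖
    have p5 := sq_nonneg ‖x.vt‖
    have z1 : wd x.u = 0 := norm_eq_zero.1 (pow_eq_zero_iff two_ne_zero |>.1 (by linarith))
    have z2 : x.v = 0 := norm_eq_zero.1 (pow_eq_zero_iff two_ne_zero |>.1 (by linarith))
    have z3 : x.w = 0 := norm_eq_zero.1 (pow_eq_zero_iff two_ne_zero |>.1 (by linarith))
    have z4 : wd x.ut = 0 := norm_eq_zero.1 (pow_eq_zero_iff two_ne_zero |>.1 (by linarith))
    have z5 : x.vt = 0 := norm_eq_zero.1 (pow_eq_zero_iff two_ne_zero |>.1 (by linarith))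
    exact X.ext
      (eq_zero_of_wd_eq_zero one_pos (by norm_num) x.u_mem z1 x.u_zero) z2 z3
      (eq_zero_of_wd_eq_zero (by norm_num) (by norm_num) x.ut_mem z4 x.ut_three) z5

end X

instance : NormedAddCommGroup X := X.core.toNormedAddCommGroup

instance : InnerProductSpace ℂ X := InnerProductSpace.ofCore X.core.toCore

/-- `‖(u,v,w,ũ,ṽ)‖² = ‖u'‖² + ‖v‖² + ‖w‖² + ‖ũ'‖² + ‖ṽ‖²`. -/
lemma X.norm_sq (x : X) : ‖x‖ ^ 2 =
    ‖wd x.u‖ ^ 2 + ‖x.v‖ ^ 2 + ‖x.w‖ ^ 2 + ‖wd x.ut‖ ^ 2 + ‖x.vt‖ ^ 2 := by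
  rw [← X.re_innerX_self, ← inner_self_eq_norm_sq (𝕜 := ℂ)]
  rfl

/-! The operator `A` -/

/-- The domain `D(A)`: all `(u,v,w,ũ,ṽ) ∈ X` with `u ∈ H²(0,1)`, `v ∈ H¹(0,1)`, `w ∈ H²(1,2)`,
`ũ ∈ H²(2,3)`, `ṽ ∈ H¹(2,3)` and `v(0) = ṽ(3) = 0`, `u'(1) = w'(1)`, `v(1) = w(1)`,
`ũ'(2) = w'(2)`, `ṽ(2) = w(2)`. -/
structure InDomain (x : X) : Prop where
  u_mem : x.u ∈ H2 0 1
  v_mem : x.v ∈ H1 0 1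
  w_mem : x.w ∈ H2 1 2
  ut_mem : x.ut ∈ H2 2 3
  vt_mem : x.vt ∈ H1 2 3
  v_zero : HasValue x.v 0 0
  vt_three : HasValue x.vt 3 0
  flux_one : SameValue (wd x.u) (wd x.w) 1
  value_one : SameValue x.v x.w 1
  flux_two : SameValue (wd x.ut) (wd x.w) 2
  value_two : SameValue x.vt x.w 2

/-- `D(A)` as a subspace of `X`. -/
def domainA : Submodule ℂ X where
  carrier := {x | InDomain x}
  zero_mem' :=
    { u_mem := zero_mem _
      v_mem := zero_mem _
      w_mem := zero_mem _
      ut_mem := zero_mem _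
      vt_mem := zero_mem _
      v_zero := HasValue.zero
      vt_three := HasValue.zero
      flux_one := by simp only [X.zero_u, X.zero_w, wd_zero]; exact SameValue.zero
      value_one := SameValue.zero
      flux_two := by simp only [X.zero_ut, X.zero_w, wd_zero]; exact SameValue.zero
      value_two := SameValue.zero }
  add_mem' {x y} hx hy :=
    { u_mem := add_mem hx.u_mem hy.u_mem
      v_mem := add_mem hx.v_mem hy.v_mem
      w_mem := add_mem hx.w_mem hy.w_mem
      ut_mem := add_mem hx.ut_mem hy.ut_mem
      vt_mem := add_mem hx.vt_mem hy.vt_mem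
      v_zero := hx.v_zero.add_zero hy.v_zero
      vt_three := hx.vt_three.add_zero hy.vt_three
      flux_one := by
        rw [X.add_u, X.add_w, wd_add hx.u_mem.1 hy.u_mem.1, wd_add hx.w_mem.1 hy.w_mem.1]
        exact hx.flux_one.add hy.flux_one
      value_one := hx.value_one.add hy.value_one
      flux_two := by
        rw [X.add_ut, X.add_w, wd_add hx.ut_mem.1 hy.ut_mem.1, wd_add hx.w_mem.1 hy.w_mem.1]
        exact hx.flux_two.add hy.flux_two
      value_two := hx.value_two.add hy.value_two }
  smul_mem' c x hx :=
    { u_mem := Submodule.smul_mem _ c hx.u_mem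
      v_mem := Submodule.smul_mem _ c hx.v_mem
      w_mem := Submodule.smul_mem _ c hx.w_mem
      ut_mem := Submodule.smul_mem _ c hx.ut_mem
      vt_mem := Submodule.smul_mem _ c hx.vt_mem
      v_zero := hx.v_zero.smul_zero c
      vt_three := hx.vt_three.smul_zero c
      flux_one := by
        rw [X.smul_u, X.smul_w, wd_smul c hx.u_mem.1, wd_smul c hx.w_mem.1]
        exact hx.flux_one.smul c
      value_one := hx.value_one.smul c
      flux_two := by
        rw [X.smul_ut, X.smul_w, wd_smul c hx.ut_mem.1, wd_smul c hx.w_mem.1]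
        exact hx.flux_two.smul c
      value_two := hx.value_two.smul c }

/-- The element of `X` with the given components. -/
def X.mk (f : L2 0 1) (g : L2 0 1) (h : L2 1 2) (ft : L2 2 3) (gt : L2 2 3)
    (h1 : f ∈ H1 0 1) (h2 : ft ∈ H1 2 3) (h3 : HasValue f 0 0) (h4 : HasValue ft 3 0) : X :=
  ⟨(f, g, h, ft, gt), h1, h2, h3, h4⟩

section
variable (f g : L2 0 1) (h : L2 1 2) (ft gt : L2 2 3)
    (h1 : f ∈ H1 0 1) (h2 : ft ∈ H1 2 3) (h3 : HasValue f 0 0) (h4 : HasValue ft 3 0)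
@[simp] lemma X.mk_u : (X.mk f g h ft gt h1 h2 h3 h4).u = f := rfl
@[simp] lemma X.mk_v : (X.mk f g h ft gt h1 h2 h3 h4).v = g := rfl
@[simp] lemma X.mk_w : (X.mk f g h ft gt h1 h2 h3 h4).w = h := rfl
@[simp] lemma X.mk_ut : (X.mk f g h ft gt h1 h2 h3 h4).ut = ft := rfl
@[simp] lemma X.mk_vt : (X.mk f g h ft gt h1 h2 h3 h4).vt = gt := rfl
end

/-- The action `(u,v,w,ũ,ṽ) ↦ (v, u'', w'', ṽ, ũ'')` on `D(A)`. -/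
def act (x : X) (hx : InDomain x) : X :=
  X.mk x.v (wd (wd x.u)) (wd (wd x.w)) x.vt (wd (wd x.ut))
    hx.v_mem hx.vt_mem hx.v_zero hx.vt_three

lemma act_u (x : X) (hx : InDomain x) : (act x hx).u = x.v := X.mk_u ..
lemma act_v (x : X) (hx : InDomain x) : (act x hx).v = wd (wd x.u) := X.mk_v ..
lemma act_w (x : X) (hx : InDomain x) : (act x hx).w = wd (wd x.w) := X.mk_w ..
lemma act_ut (x : X) (hx : InDomain x) : (act x hx).ut = x.vt := X.mk_ut ..
lemma act_vt (x : X) (hx : InDomain x) : (act x hx).vt = wd (wd x.ut) := X.mk_vt ..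

lemma act_add {x y : X} (hx : InDomain x) (hy : InDomain y) (hxy : InDomain (x + y)) :
    act (x + y) hxy = act x hx + act y hy := by
  apply X.ext
  · rw [X.add_u, act_u, act_u, act_u, X.add_v]
  · rw [X.add_v, act_v, act_v, act_v, X.add_u, wd_wd_add hx.u_mem hy.u_mem]
  · rw [X.add_w, act_w, act_w, act_w, X.add_w, wd_wd_add hx.w_mem hy.w_mem]
  · rw [X.add_ut, act_ut, act_ut, act_ut, X.add_vt]
  · rw [X.add_vt, act_vt, act_vt, act_vt, X.add_ut, wd_wd_add hx.ut_mem hy.ut_mem]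

lemma act_smul (c : ℂ) {x : X} (hx : InDomain x) (hcx : InDomain (c • x)) :
    act (c • x) hcx = c • act x hx := by
  apply X.ext
  · rw [X.smul_u, act_u, act_u, X.smul_v]
  · rw [X.smul_v, act_v, act_v, X.smul_u, wd_wd_smul c hx.u_mem]
  · rw [X.smul_w, act_w, act_w, X.smul_w, wd_wd_smul c hx.w_mem]
  · rw [X.smul_ut, act_ut, act_ut, X.smul_vt]
  · rw [X.smul_vt, act_vt, act_vt, X.smul_ut, wd_wd_smul c hx.ut_mem]

/-- The operator `A (u,v,w,ũ,ṽ) = (v, u'', w'', ṽ, ũ'')` on `X` with domain `D(A)`. -/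
def A : X →ₗ.[ℂ] X where
  domain := domainA
  toFun :=
    { toFun := fun x => act x.1 x.2
      map_add' := fun x y => act_add x.2 y.2 (x + y).2
      map_smul' := fun c x => act_smul c x.2 (c • x).2 }

lemma mem_domain_A {x : X} : x ∈ A.domain ↔ InDomain x := Iff.rfl

lemma A_apply (x : A.domain) : A x = act x.1 x.2 := rfl

/-! Spectrum of an unbounded operator -/

/-- `z ∈ ρ(T)`: the map `z - T : D(T) → E` has a bounded everywhere defined two-sided inverse. -/
def InResolventSet {E : Type*} [NormedAddCommGroup E] [NormedSpace ℂ E]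
    (T : E →ₗ.[ℂ] E) (z : ℂ) : Prop :=
  ∃ R : E →L[ℂ] E,
    (∀ y : E, ∃ x : T.domain, (x : E) = R y ∧ z • (x : E) - T x = y) ∧
    ∀ x : T.domain, R (z • (x : E) - T x) = x

/-- The spectrum `σ(T) = ℂ \ ρ(T)`. -/
def spec {E : Type*} [NormedAddCommGroup E] [NormedSpace ℂ E] (T : E →ₗ.[ℂ] E) : Set ℂ :=
  {z | ¬ InResolventSet T z}

/-- `z` is an eigenvalue of `T`. -/
def IsEigenvalue {E : Type*} [NormedAddCommGroup E] [NormedSpace ℂ E]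
    (T : E →ₗ.[ℂ] E) (z : ℂ) : Prop :=
  ∃ x : T.domain, (x : E) ≠ 0 ∧ T x = z • (x : E)

/-! The characteristic matrix -/

/-- The principal square root: `√(r e^{iθ}) = r^{1/2} e^{iθ/2}` for `r ≥ 0`, `θ ∈ (-π, π]`. -/
def csqrt (z : ℂ) : ℂ := z ^ (1 / 2 : ℂ)

/-- The matrix `M_z`. -/
def M (z : ℂ) : Matrix (Fin 4) (Fin 4) ℂ :=
  !![z * Complex.sinh z, -1, 0, 0;
     z * Complex.cosh z, 0, -csqrt z, 0;
     0, -Complex.cosh (csqrt z), -Complex.sinh (csqrt z), z * Complex.sinh z;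
     0, csqrt z * Complex.sinh (csqrt z), csqrt z * Complex.cosh (csqrt z), z * Complex.cosh z]

end WaveHeatWave

end

open MeasureTheory Set Topology
open scoped ContDiff ComplexConjugate

noncomputable section

namespace WaveHeatWave

/-! Continuous functions as elements of `L²(a,b)` -/

/-! The operator `A` has an explicit compact inverse. To solve `A x = y`, integrate each component;
the boundary and transmission conditions fix all constants once the common flux `u'(1) = w'(1)` is
known, and the condition `ṽ(2) = w(2)` determines that flux (`inDomain_inverseA`). The solution is
built from Volterra operators, which are compact as norm limits of finite rank operators
(`isCompactOperator_volterra`), and from terms of rank one. By the Fredholm alternative `σ(A)`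
consists of eigenvalues, and `0 ∉ σ(A)` (`mem_spec_A_iff`, `zero_notMem_spec_A`).

For `z ≠ 0` an eigenvector satisfies `v = z u`, `u'' = z² u`, `w'' = z w`, and likewise for `ũ`,
`ṽ`. With the outer boundary conditions, `u`, `w`, `ũ` are combinations of `sinh` and `cosh` with
four free coefficients, and the four transmission conditions on these say `M_z q = 0`. Hence `z` is
an eigenvalue exactly when `det M_z = 0`.

It remains to study the determinant. One has `det M_z = -z² F(√z)` with `F` (`charFun`) entire and
odd. It factors into terms `C a + S b` with `C = cosh s²`, `S = sinh s²`. If such a term vanished,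
`C S̄ |a|² = -|S|² b ā`. But for `s = x + iy ≠ 0` with `Re s² ≥ 0` the real part of `C S̄` is
nonnegative, while that of `b ā` is `(x sinh x ± y sin y)/2 > 0`, because `|y| ≤ |x|`. So `det M_z ≠
0` when `Re z ≥ 0` and `z ≠ 0` (`det_M_ne_zero`): the condition `Re z < 0` discards only the
spurious zero `z = 0`. Points of the spectrum are isolated because `F` is a nonzero entire function;
its oddness neutralizes the branch cut of the square root. -/

lemma memLp_of_continuous {a b : ℝ} {c : ℝ → ℂ} (hc : Continuous c) :
    MemLp c 2 (volume.restrict (Ioo a b)) := by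
  obtain ⟨C, hC⟩ := (isCompact_Icc (a := a) (b := b)).exists_bound_of_continuousOn hc.continuousOn
  refine MemLp.of_bound hc.aestronglyMeasurable C ?_
  filter_upwards [ae_restrict_mem measurableSet_Ioo] with x hx
  exact hC x (Ioo_subset_Icc_self hx)

/-- The class in `L²(a,b)` of a continuous function. -/
def ofCont (a b : ℝ) (c : ℝ → ℂ) (hc : Continuous c) : L2 a b := (memLp_of_continuous hc).toLp c

lemma ofCont_ae {a b : ℝ} {c : ℝ → ℂ} (hc : Continuous c) :
    ofCont a b c hc =ᵐ[volume.restrict (Ioo a b)] c := MemLp.coeFn_toLp _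

lemma hasValue_ofCont {a b : ℝ} {c : ℝ → ℂ} (hc : Continuous c) (p : ℝ) :
    HasValue (ofCont a b c hc) p (c p) := ⟨c, hc.continuousOn, ofCont_ae hc, rfl⟩

/-! ### Uniqueness of continuous representatives; classical and weak derivatives -/

lemma eqOn_Icc_of_ae_eq {a b : ℝ} (hab : a < b) {c d : ℝ → ℂ} (hc : ContinuousOn c (Icc a b))
    (hd : ContinuousOn d (Icc a b)) (h : c =ᵐ[volume.restrict (Ioo a b)] d) :
    EqOn c d (Icc a b) := by
  refine Measure.eqOn_Icc_of_ae_eq volume hab.ne ?_ hc hd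
  rwa [← restrict_Ioo_eq_restrict_Icc]

/-- Continuous representatives that agree almost everywhere agree on all of `[a,b]`, so point values
of `L²` classes are well defined there. For `p` outside `[a,b]` nothing constrains the
representative. -/
lemma HasValue.unique {a b p : ℝ} (hab : a < b) (hp : p ∈ Icc a b) {f : L2 a b} {z w : ℂ}
    (h₁ : HasValue f p z) (h₂ : HasValue f p w) : z = w := by
  obtain ⟨c, hc, hfc, rfl⟩ := h₁
  obtain ⟨d, hd, hfd, rfl⟩ := h₂
  exact eqOn_Icc_of_ae_eq hab hc hd (hfc.symm.trans hfd) hp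

lemma HasValue.eq_of_ae {a b p : ℝ} (hab : a < b) (hp : p ∈ Icc a b) {f : L2 a b} {z : ℂ}
    {c : ℝ → ℂ} (hc : ContinuousOn c (Icc a b)) (hf : f =ᵐ[volume.restrict (Ioo a b)] c)
    (h : HasValue f p z) : c p = z :=
  HasValue.unique hab hp ⟨c, hc, hf, rfl⟩ h

/-- Classical derivatives are weak derivatives. -/
lemma isWeakDeriv_of_hasDerivAt {a b : ℝ} (hab : a ≤ b) {f g : L2 a b} {c d : ℝ → ℂ}
    (hc : ∀ x ∈ Icc a b, HasDerivAt c (d x) x) (hd : ContinuousOn d (Icc a b))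
    (hf : f =ᵐ[volume.restrict (Ioo a b)] c) (hg : g =ᵐ[volume.restrict (Ioo a b)] d) :
    IsWeakDeriv f g := by
  intro φ hφ
  have hcc : ContinuousOn c (Icc a b) := fun x hx => (hc x hx).continuousAt.continuousWithinAt
  have hφd : ∀ x, HasDerivAt φ (deriv φ x) x := fun x =>
    (hφ.1.differentiable (by simp) x).hasDerivAt
  have hφ' : Continuous (deriv φ) := hφ.1.continuous_deriv (by simp)
  have hφ0 : ∀ x, x ∉ Ioo a b → φ x = 0 := fun x hx =>
    image_eq_zero_of_notMem_tsupport fun h => hx (hφ.2.2 h)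
  have e₁ : ∫ x in Ioo a b, deriv φ x • f x = ∫ x in a..b, deriv φ x • c x := by
    rw [intervalIntegral.integral_of_le hab, integral_Ioc_eq_integral_Ioo]
    refine integral_congr_ae ?_
    filter_upwards [hf] with x hx
    rw [hx]
  have e₂ : ∫ x in Ioo a b, φ x • g x = ∫ x in a..b, φ x • d x := by
    rw [intervalIntegral.integral_of_le hab, integral_Ioc_eq_integral_Ioo]
    refine integral_congr_ae ?_
    filter_upwards [hg] with x hx
    rw [hx]
  have i₁ : IntervalIntegrable (fun x => deriv φ x • c x) volume a b := by
    refine ContinuousOn.intervalIntegrable ?_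
    rw [uIcc_of_le hab]
    exact hφ'.continuousOn.smul hcc
  have i₂ : IntervalIntegrable (fun x => φ x • d x) volume a b := by
    refine ContinuousOn.intervalIntegrable ?_
    rw [uIcc_of_le hab]
    exact hφ.1.continuous.continuousOn.smul hd
  -- The integral of `(φ c)'` over `[a,b]` is zero, since `φ` vanishes at both endpoints.
  have key := intervalIntegral.integral_eq_sub_of_hasDerivAt (a := a) (b := b)
    (f := fun x => φ x • c x) (f' := fun x => φ x • d x + deriv φ x • c x)
    (fun x hx => (hφd x).smul (hc x (by rwa [uIcc_of_le hab] at hx))) (i₂.add i₁)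
  rw [intervalIntegral.integral_add i₂ i₁, hφ0 a (by simp), hφ0 b (by simp)] at key
  rw [e₁, e₂]
  simp only [zero_smul, sub_zero] at key
  exact eq_neg_of_add_eq_zero_right key

/-- The constant function `k` as an element of `L²(a,b)`. -/
def constL2 (a b : ℝ) : ℂ →L[ℂ] L2 a b := Lp.constL 2 (volume.restrict (Ioo a b)) ℂ

lemma constL2_ae {a b : ℝ} (k : ℂ) :
    constL2 a b k =ᵐ[volume.restrict (Ioo a b)] fun _ => k := Lp.coeFn_const ..

lemma hasValue_constL2 {a b : ℝ} (k : ℂ) (p : ℝ) : HasValue (constL2 a b k) p k :=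
  ⟨fun _ => k, continuousOn_const, constL2_ae k, rfl⟩

lemma isWeakDeriv_constL2 {a b : ℝ} (hab : a ≤ b) (k : ℂ) : IsWeakDeriv (constL2 a b k) 0 :=
  isWeakDeriv_of_hasDerivAt hab (fun x _ => hasDerivAt_const x k) continuousOn_const
    (constL2_ae k) (Lp.coeFn_zero ..)

/-! The Volterra operator -/

/-- The indicator function of `(a,x]` in `L²(a,b)`. -/
def indIic (a b x : ℝ) : L2 a b :=
  indicatorConstLp 2 (measurableSet_Iic (a := x)) (measure_ne_top _ _) (1 : ℂ)

/-- The primitive `x ↦ ∫_a^x g` of `g ∈ L²(a,b)`. -/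
def prim {a b : ℝ} (g : L2 a b) (x : ℝ) : ℂ := inner ℂ (indIic a b x) g

lemma prim_eq_of_ae {a b x : ℝ} (hx : x ∈ Icc a b) {g : L2 a b} {c : ℝ → ℂ}
    (hg : g =ᵐ[volume.restrict (Ioo a b)] c) : prim g x = ∫ t in a..x, c t := by
  rw [prim, indIic, L2.inner_indicatorConstLp_one, Measure.restrict_restrict measurableSet_Iic,
    intervalIntegral.integral_of_le hx.1]
  have h1 : (∫ t in Iic x ∩ Ioo a b, g t) = ∫ t in Iic x ∩ Ioo a b, c t := by
    refine integral_congr_ae ?_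
    exact ae_restrict_of_ae_restrict_of_subset inter_subset_right hg
  rw [h1]
  refine setIntegral_congr_set ?_
  -- With `Iio` instead of `Iic` the cases `x < b` and `x = b` are treated alike; the endpoints are
  -- null sets.
  have h2 : Iio x ∩ Ioo a b = Ioo a x := by
    ext t
    simp only [mem_inter_iff, mem_Iio, mem_Ioo]
    exact ⟨fun h => ⟨h.2.1, h.1⟩, fun h => ⟨h.2, h.1, h.2.trans_le hx.2⟩⟩
  have h3 : (Iic x ∩ Ioo a b : Set ℝ) =ᵐ[volume] (Iio x ∩ Ioo a b : Set ℝ) :=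
    Iio_ae_eq_Iic.symm.inter (Filter.EventuallyEq.refl _ _)
  rw [h2] at h3
  exact h3.trans Ioo_ae_eq_Ioc

lemma prim_eq {a b x : ℝ} (hx : x ∈ Icc a b) (g : L2 a b) : prim g x = ∫ t in a..x, g t :=
  prim_eq_of_ae hx Filter.EventuallyEq.rfl

@[simp] lemma prim_left {a b : ℝ} (hab : a ≤ b) (g : L2 a b) : prim g a = 0 := by
  rw [prim_eq ⟨le_rfl, hab⟩, intervalIntegral.integral_same]

/-- The difference is the indicator of `(x,y]`. By Cauchy–Schwarz, primitives are therefore Hölder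
continuous of exponent 1/2, uniformly on bounded sets of `L²`; this is the source of compactness. -/
lemma norm_indIic_sub_le {a b x y : ℝ} (hxy : x ≤ y) :
    ‖indIic a b y - indIic a b x‖ ≤ √(y - x) := by
  have e : indIic a b y - indIic a b x =
      indicatorConstLp 2 (measurableSet_Ioc (a := x) (b := y)) (measure_ne_top _ _) (1 : ℂ) := by
    rw [sub_eq_iff_eq_add', indIic, indIic, ← indicatorConstLp_disjoint_union]
    · congr 1
      exact (Iic_union_Ioc_eq_Iic hxy).symm
    · exact disjoint_left.2 fun t h1 h2 => not_lt.2 h1 h2.1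
  rw [e]
  refine norm_indicatorConstLp_le.trans ?_
  have h : (volume.restrict (Ioo a b)).real (Ioc x y) ≤ y - x := by
    refine (ENNReal.toReal_mono (b := volume (Ioc x y)) (by simp)
      (Measure.restrict_apply_le _ _)).trans ?_
    rw [Real.volume_Ioc, ENNReal.toReal_ofReal (by linarith)]
  rw [norm_one, one_mul, Real.sqrt_eq_rpow, ENNReal.toReal_ofNat]
  exact Real.rpow_le_rpow measureReal_nonneg h (by norm_num)

lemma norm_prim_sub_le {a b x y : ℝ} (hxy : x ≤ y) (g : L2 a b) :
    ‖prim g y - prim g x‖ ≤ √(y - x) * ‖g‖ := by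
  rw [prim, prim, ← inner_sub_left]
  exact (norm_inner_le_norm _ _).trans
    (mul_le_mul_of_nonneg_right (norm_indIic_sub_le hxy) (norm_nonneg _))

lemma continuous_indIic (a b : ℝ) : Continuous (indIic a b) := by
  have h : ∀ x y, dist (indIic a b x) (indIic a b y) ≤ √(dist x y) := by
    intro x y
    rcases le_total x y with h | h
    · rw [dist_comm, dist_eq_norm, dist_comm, Real.dist_eq, abs_of_nonneg (by linarith)]
      exact norm_indIic_sub_le h
    · rw [dist_eq_norm, Real.dist_eq, abs_of_nonneg (by linarith)]
      exact norm_indIic_sub_le h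
  rw [continuous_iff_continuousAt]
  intro x
  rw [ContinuousAt, tendsto_iff_dist_tendsto_zero]
  refine squeeze_zero (fun _ => dist_nonneg) (fun y => h y x) ?_
  have : Continuous fun y => √(dist y x) := by fun_prop
  simpa using this.tendsto x

lemma continuous_prim {a b : ℝ} (g : L2 a b) : Continuous (prim g) :=
  (continuous_indIic a b).inner continuous_const

lemma norm_prim_le {a b x : ℝ} (hx : x ∈ Icc a b) (g : L2 a b) :
    ‖prim g x‖ ≤ √(b - a) * ‖g‖ := by
  have h := norm_prim_sub_le hx.1 g
  rw [prim_left (hx.1.trans hx.2), sub_zero] at h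
  exact h.trans (mul_le_mul_of_nonneg_right (Real.sqrt_le_sqrt (by linarith [hx.2]))
    (norm_nonneg _))

lemma norm_le_of_bound {a b C : ℝ} (hC : 0 ≤ C) {f : L2 a b}
    (h : ∀ᵐ x ∂volume.restrict (Ioo a b), ‖f x‖ ≤ C) : ‖f‖ ≤ √(b - a) * C := by
  refine (Lp.norm_le_of_ae_bound hC h).trans (mul_le_mul_of_nonneg_right ?_ hC)
  -- The truncation `max (b - a) 0` covers the empty interval; there `√(b - a)` is zero as well.
  have e : (measureUnivNNReal (volume.restrict (Ioo a b)) : ℝ) = max (b - a) 0 := by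
    simp [measureUnivNNReal, ENNReal.coe_toNNReal_eq_toReal, ENNReal.toReal_ofReal']
  rw [e, Real.sqrt_eq_rpow]
  rcases le_total a b with hab | hab
  · rw [max_eq_left (by linarith)]
    norm_num
  · rw [max_eq_right (by linarith), ← Real.sqrt_eq_rpow]
    norm_num

/-- The Volterra operator `(V g)(x) = ∫_a^x g` on `L²(a,b)`. -/
def volterra (a b : ℝ) : L2 a b →L[ℂ] L2 a b :=
  LinearMap.mkContinuous
    { toFun := fun g => ofCont a b (prim g) (continuous_prim g)
      map_add' := fun f g => by
        refine Lp.ext ?_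
        filter_upwards [ofCont_ae (a := a) (b := b) (continuous_prim (f + g)),
          Lp.coeFn_add (ofCont a b _ (continuous_prim f)) (ofCont a b _ (continuous_prim g)),
          ofCont_ae (a := a) (b := b) (continuous_prim f),
          ofCont_ae (a := a) (b := b) (continuous_prim g)] with x h1 h2 h3 h4
        rw [h1, h2, Pi.add_apply, h3, h4, prim, inner_add_right, prim, prim]
      map_smul' := fun k g => by
        refine Lp.ext ?_
        filter_upwards [ofCont_ae (a := a) (b := b) (continuous_prim (k • g)),
          Lp.coeFn_smul k (ofCont a b _ (continuous_prim g)),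
          ofCont_ae (a := a) (b := b) (continuous_prim g)] with x h1 h2 h3
        rw [RingHom.id_apply, h1, h2, Pi.smul_apply, h3, prim, inner_smul_right, prim,
          smul_eq_mul] }
    -- One factor bounds the primitive uniformly by `‖g‖`, the other passes from the uniform norm to
    -- `L²`.
    (√(b - a) * √(b - a)) fun g => by
      rw [mul_assoc]
      refine norm_le_of_bound (by positivity) ?_
      filter_upwards [ofCont_ae (a := a) (b := b) (continuous_prim g),
        ae_restrict_mem measurableSet_Ioo] with x h1 h2
      rw [LinearMap.coe_mk, AddHom.coe_mk, h1]
      exact norm_prim_le (Ioo_subset_Icc_self h2) g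

lemma volterra_ae {a b : ℝ} (g : L2 a b) :
    volterra a b g =ᵐ[volume.restrict (Ioo a b)] prim g := ofCont_ae (continuous_prim g)

lemma hasValue_volterra {a b : ℝ} (g : L2 a b) (p : ℝ) : HasValue (volterra a b g) p (prim g p) :=
  ⟨prim g, (continuous_prim g).continuousOn, volterra_ae g, rfl⟩

/-- The functional `g ↦ ∫_a^b g` on `L²(a,b)`. -/
def total (a b : ℝ) : L2 a b →L[ℂ] ℂ := innerSL ℂ (indIic a b b)

lemma total_apply {a b : ℝ} (g : L2 a b) : total a b g = prim g b := rfl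

/-- Both sides of the defining identity depend continuously on `g`, so it is enough to check it on
the dense set of bounded continuous functions, where the classical fundamental theorem applies. -/
lemma isWeakDeriv_volterra {a b : ℝ} (hab : a ≤ b) (g : L2 a b) :
    IsWeakDeriv (volterra a b g) g := by
  intro φ hφ
  have hT : ∀ ψ : ℝ → ℝ, Continuous ψ →
      Continuous fun f : L2 a b => ∫ x in Ioo a b, ψ x • f x := by
    intro ψ hψ
    have hψ' : Continuous fun x => (ψ x : ℂ) := Complex.continuous_ofReal.comp hψ
    have e : (fun f : L2 a b => ∫ x in Ioo a b, ψ x • f x) =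
        fun f => inner ℂ (ofCont a b _ hψ') f := by
      funext f
      rw [L2.inner_def]
      refine integral_congr_ae ?_
      filter_upwards [ofCont_ae (a := a) (b := b) hψ'] with x hx
      rw [hx, RCLike.inner_apply, Complex.conj_ofReal, Complex.real_smul, mul_comm]
    rw [e]
    exact continuous_const.inner continuous_id
  have h1 := (hT _ (hφ.1.continuous_deriv (by simp))).comp (volterra a b).continuous
  have h2 := (hT _ hφ.1.continuous).neg
  have hd := BoundedContinuousFunction.toLp_denseRange ℂ (volume.restrict (Ioo a b)) ℂ
    (p := 2) (by norm_num)
  refine congrFun (hd.equalizer h1 h2 ?_) g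
  funext c
  have hc : (BoundedContinuousFunction.toLp 2 (volume.restrict (Ioo a b)) ℂ c : L2 a b)
      =ᵐ[volume.restrict (Ioo a b)] c := BoundedContinuousFunction.coeFn_toLp ..
  refine isWeakDeriv_of_hasDerivAt hab (c := fun x => ∫ t in a..x, c t) (d := c)
    (fun x _ => (c.continuous.integral_hasStrictDerivAt a x).hasDerivAt)
    c.continuous.continuousOn ?_ hc φ hφ
  filter_upwards [volterra_ae (BoundedContinuousFunction.toLp 2 (volume.restrict (Ioo a b)) ℂ c),
    ae_restrict_mem measurableSet_Ioo] with x h3 h4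
  rw [h3]
  exact prim_eq_of_ae (Ioo_subset_Icc_self h4) hc

/-- Every `f ∈ H¹(a,b)` is a primitive of its weak derivative. -/
lemma IsWeakDeriv.eq_volterra_add_const {a b : ℝ} (hab : a < b) {f g : L2 a b}
    (h : IsWeakDeriv f g) : ∃ k : ℂ, f = volterra a b g + constL2 a b k := by
  have h0 : IsWeakDeriv (f + (-1 : ℂ) • volterra a b g) 0 := by
    simpa using h.add ((isWeakDeriv_volterra hab.le g).smul (-1))
  obtain ⟨k, hk⟩ := ae_const_of_weakDeriv_zero hab h0
  refine ⟨k, ?_⟩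
  have h1 : f + (-1 : ℂ) • volterra a b g = constL2 a b k := Lp.ext (hk.trans (constL2_ae k).symm)
  rw [← h1]
  module

lemma IsWeakDeriv.eq_of_hasValue {a b p : ℝ} (hab : a < b) (hp : p ∈ Icc a b) {f g : L2 a b}
    {z : ℂ} (h : IsWeakDeriv f g) (hz : HasValue f p z) :
    f = volterra a b g + constL2 a b (z - prim g p) := by
  obtain ⟨k, rfl⟩ := h.eq_volterra_add_const hab
  have := hz.unique hab hp ((hasValue_volterra g p).add (hasValue_constL2 k p))
  rw [this, add_sub_cancel_left]

/-- If the weak derivative of `f` is continuous, then `f` is continuously differentiable. -/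
lemma IsWeakDeriv.exists_hasDerivAt {a b : ℝ} (hab : a < b) {f g : L2 a b} (h : IsWeakDeriv f g)
    {d : ℝ → ℂ} (hd : ContinuousOn d (Icc a b)) (hg : g =ᵐ[volume.restrict (Ioo a b)] d) :
    ∃ c : ℝ → ℂ, f =ᵐ[volume.restrict (Ioo a b)] c ∧ ∀ x ∈ Icc a b, HasDerivAt c (d x) x := by
  obtain ⟨k, rfl⟩ := h.eq_volterra_add_const hab
  -- Extending `d` continuously to the line makes the primitive differentiable from both sides, even
  -- at `a` and `b`.
  have hD : Continuous (IccExtend hab.le ((Icc a b).domRestrict d)) :=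
    (continuousOn_iff_continuous_domRestrict.1 hd).Icc_extend'
  have hDd : EqOn (IccExtend hab.le ((Icc a b).domRestrict d)) d (Icc a b) := fun x hx => by
    rw [IccExtend_of_mem _ _ hx, domRestrict_apply]
  refine ⟨fun x => (∫ t in a..x, IccExtend hab.le ((Icc a b).domRestrict d) t) + k, ?_,
    fun x hx => ?_⟩
  · filter_upwards [Lp.coeFn_add (volterra a b g) (constL2 a b k), volterra_ae g,
      constL2_ae (a := a) (b := b) k, ae_restrict_mem measurableSet_Ioo] with x h1 h2 h3 h4
    rw [h1, Pi.add_apply, h2, h3, prim_eq_of_ae (Ioo_subset_Icc_self h4) (hg.trans ?_)]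
    filter_upwards [ae_restrict_mem measurableSet_Ioo] with y hy
    exact (hDd (Ioo_subset_Icc_self hy)).symm
  · rw [← hDd hx]
    exact (hD.integral_hasStrictDerivAt a x).hasDerivAt.add_const k

/-! Compactness of the Volterra operator -/

lemma coeFn_finset_sum {a b : ℝ} {ι : Type*} (s : Finset ι) (f : ι → L2 a b) :
    (∑ i ∈ s, f i : L2 a b) =ᵐ[volume.restrict (Ioo a b)] fun x => ∑ i ∈ s, f i x := by
  classical
  induction s using Finset.induction_on with
  | empty =>
    rw [Finset.sum_empty]
    filter_upwards [Lp.coeFn_zero ℂ 2 (volume.restrict (Ioo a b))] with x hx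
    rw [hx, Pi.zero_apply, Finset.sum_empty]
  | insert i s hi ih =>
    rw [Finset.sum_insert hi]
    filter_upwards [Lp.coeFn_add (f i) (∑ i ∈ s, f i), ih] with x h1 h2
    rw [h1, Pi.add_apply, h2, Finset.sum_insert hi]

lemma measurableSet_floor_mul_eq (n : ℕ) (k : ℤ) : MeasurableSet {x : ℝ | ⌊n * x⌋ = k} :=
  measurableSet_eq_fun (Int.measurable_floor.comp (measurable_const.mul measurable_id))
    measurable_const

/-- The finite rank operator `(W g)(x) = ∫_a^{⌊n x⌋ / n} g` approximating the Volterra operator. -/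
def staircase (a b : ℝ) (n : ℕ) : L2 a b →L[ℂ] L2 a b :=
  ∑ k ∈ Finset.Icc ⌊n * a⌋ ⌊n * b⌋, (innerSL ℂ (indIic a b (k / n))).smulRight
    (indicatorConstLp 2 (measurableSet_floor_mul_eq n k) (measure_ne_top _ _) (1 : ℂ))

/-- Each summand factors through the locally compact space `ℂ`. -/
lemma isCompactOperator_staircase (a b : ℝ) (n : ℕ) : IsCompactOperator (staircase a b n) := by
  have h : staircase a b n ∈ compactOperator (RingHom.id ℂ) (L2 a b) (L2 a b) := by
    refine Submodule.sum_mem _ fun k _ => ?_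
    have : IsCompactOperator (ContinuousLinearMap.toSpanSingleton ℂ
        (indicatorConstLp 2 (measurableSet_floor_mul_eq n k)
          (measure_ne_top (volume.restrict (Ioo a b)) _) (1 : ℂ))) :=
      isCompactOperator_of_locallyCompactSpace_rng _
    exact this.comp_clm (innerSL ℂ (indIic a b (k / n)))
  exact h

lemma staircase_ae {a b : ℝ} (n : ℕ) (g : L2 a b) :
    ∀ᵐ x ∂volume.restrict (Ioo a b), staircase a b n g x = prim g (⌊n * x⌋ / n) := by
  have e : staircase a b n g = ∑ k ∈ Finset.Icc ⌊n * a⌋ ⌊n * b⌋, prim g (k / n) •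
      (indicatorConstLp 2 (measurableSet_floor_mul_eq n k)
        (measure_ne_top (volume.restrict (Ioo a b)) _) (1 : ℂ) : L2 a b) := by
    rw [staircase, sum_apply]
    rfl
  have h1 : ∀ᵐ x ∂volume.restrict (Ioo a b), ∀ k : ℤ, (prim g (k / n) •
      (indicatorConstLp 2 (measurableSet_floor_mul_eq n k)
        (measure_ne_top (volume.restrict (Ioo a b)) _) (1 : ℂ) : L2 a b) : L2 a b) x =
        if ⌊n * x⌋ = k then prim g (k / n) else 0 := by
    rw [ae_all_iff]
    intro k
    filter_upwards [Lp.coeFn_smul (prim g (k / n))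
      (indicatorConstLp 2 (measurableSet_floor_mul_eq n k)
        (measure_ne_top (volume.restrict (Ioo a b)) _) (1 : ℂ) : L2 a b),
      indicatorConstLp_coeFn (p := 2) (hs := measurableSet_floor_mul_eq n k)
        (hμs := measure_ne_top (volume.restrict (Ioo a b)) _) (c := (1 : ℂ))] with x h2 h3
    rw [h2, Pi.smul_apply, h3]
    by_cases h : ⌊n * x⌋ = k <;> simp [indicator, h]
  rw [e]
  filter_upwards [coeFn_finset_sum (Finset.Icc ⌊n * a⌋ ⌊n * b⌋) fun k : ℤ => prim g (k / n) •
      (indicatorConstLp 2 (measurableSet_floor_mul_eq n k)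
        (measure_ne_top (volume.restrict (Ioo a b)) _) (1 : ℂ) : L2 a b), h1,
      ae_restrict_mem measurableSet_Ioo] with x h2 h3 h4
  rw [h2]
  simp only [h3]
  -- The level sets of `⌊n x⌋` are disjoint, so one summand survives, and `a < x < b` places its
  -- index in the range of summation.
  rw [Finset.sum_ite_eq, if_pos]
  rw [Finset.mem_Icc]
  constructor <;> refine Int.floor_le_floor (mul_le_mul_of_nonneg_left ?_ n.cast_nonneg)
  exacts [h4.1.le, h4.2.le]

/-- Rounding the upper limit down moves it by at most `1/n`, which costs `√(1/n) ‖g‖` by Hölder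
continuity. The rounded point may lie to the left of `a`, but `norm_prim_sub_le` holds for all real
arguments. -/
lemma norm_volterra_sub_staircase_le (a b : ℝ) {n : ℕ} (hn : 0 < n) :
    ‖staircase a b n - volterra a b‖ ≤ √(b - a) * √(1 / n) := by
  have hn' : (0 : ℝ) < n := Nat.cast_pos.2 hn
  refine ContinuousLinearMap.opNorm_le_bound _ (by positivity) fun g => ?_
  rw [mul_assoc]
  refine norm_le_of_bound (by positivity) ?_
  filter_upwards [staircase_ae n g, volterra_ae g,
    Lp.coeFn_sub (staircase a b n g) (volterra a b g)] with x h1 h2 h3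
  rw [sub_apply, h3, Pi.sub_apply, h1, h2, norm_sub_rev]
  have h4 : (⌊n * x⌋ / n : ℝ) ≤ x := by
    rw [div_le_iff₀ hn', mul_comm x]
    exact Int.floor_le _
  have h5 : x - (⌊n * x⌋ / n : ℝ) ≤ 1 / n := by
    rw [sub_le_iff_le_add, ← add_div, le_div_iff₀ hn', mul_comm x, add_comm]
    exact (Int.lt_floor_add_one _).le
  exact (norm_prim_sub_le h4 g).trans
    (mul_le_mul_of_nonneg_right (Real.sqrt_le_sqrt h5) (norm_nonneg _))

lemma isCompactOperator_volterra (a b : ℝ) : IsCompactOperator (volterra a b) := by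
  refine isCompactOperator_of_tendsto (l := Filter.atTop) (F := staircase a b) ?_
    (Filter.Eventually.of_forall fun n => isCompactOperator_staircase a b n)
  rw [tendsto_iff_norm_sub_tendsto_zero]
  have h : Filter.Tendsto (fun n : ℕ => √(b - a) * √(1 / n)) Filter.atTop (𝓝 0) := by
    have := ((Real.continuous_sqrt.tendsto 0).comp
      (tendsto_one_div_atTop_nhds_zero_nat (𝕜 := ℝ))).const_mul √(b - a)
    simpa using this
  refine squeeze_zero' (Filter.Eventually.of_forall fun _ => norm_nonneg _) ?_ h
  filter_upwards [Filter.eventually_gt_atTop 0] with n hn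
  exact norm_volterra_sub_staircase_le a b hn

/-! ### Spectra of operators with compact inverse -/

/-- If `T` has a compact two-sided inverse `K`, then `0 ∈ ρ(T)`. -/
lemma inResolventSet_zero_of_inverse {E : Type*} [NormedAddCommGroup E] [NormedSpace ℂ E]
    {T : E →ₗ.[ℂ] E} {K : E →L[ℂ] E} (h₁ : ∀ y, ∃ x : T.domain, (x : E) = K y ∧ T x = y)
    (h₂ : ∀ x : T.domain, K (T x) = x) : InResolventSet T 0 := by
  refine ⟨-K, fun y => ?_, fun x => ?_⟩
  · obtain ⟨x, hx, hy⟩ := h₁ (-y)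
    exact ⟨x, by rw [hx, map_neg, neg_apply], by rw [hy]; simp⟩
  · rw [zero_smul, zero_sub, neg_apply, map_neg, neg_neg, h₂]

/-- An operator with compact inverse has pure point spectrum. -/
lemma mem_spec_iff_isEigenvalue_of_compact_inverse {E : Type*} [NormedAddCommGroup E]
    [NormedSpace ℂ E] [CompleteSpace E] {T : E →ₗ.[ℂ] E} {K : E →L[ℂ] E}
    (hK : IsCompactOperator K) (h₁ : ∀ y, ∃ x : T.domain, (x : E) = K y ∧ T x = y)
    (h₂ : ∀ x : T.domain, K (T x) = x) (z : ℂ) : z ∈ spec T ↔ IsEigenvalue T z := by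
  constructor
  · intro hz
    have hz0 : z ≠ 0 := by
      rintro rfl
      exact hz (inResolventSet_zero_of_inverse h₁ h₂)
    -- Fredholm alternative for `K` at `z⁻¹`: an eigenvector of `K` is one of `T` for `z`; otherwise
    -- `B = z⁻¹ - K` is invertible.
    rcases hK.hasEigenvalue_or_mem_resolventSet (inv_ne_zero hz0) with h | h
    · obtain ⟨y, hy⟩ := h.exists_hasEigenvector
      have hKy : K y = z⁻¹ • y := hy.apply_eq_smul
      obtain ⟨x, hx, hxy⟩ := h₁ y
      refine ⟨x, ?_, ?_⟩
      · rw [hx, hKy]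
        exact smul_ne_zero (inv_ne_zero hz0) hy.2
      · rw [hxy, hx, hKy, smul_inv_smul₀ hz0]
    · refine absurd ?_ hz
      obtain ⟨B, hB⟩ := spectrum.mem_resolventSet_iff.1 h
      have hB' : ∀ y, (B : E →L[ℂ] E) y = z⁻¹ • y - K y := fun y => by
        rw [hB]
        simp [Algebra.algebraMap_eq_smul_one]
      have l₁ : ∀ y, (B : E →L[ℂ] E) ((↑B⁻¹ : E →L[ℂ] E) y) = y := fun y => by
        rw [← mul_apply_eq_comp, B.mul_inv, one_apply_eq_self]
      have l₂ : ∀ y, (↑B⁻¹ : E →L[ℂ] E) ((B : E →L[ℂ] E) y) = y := fun y => by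
        rw [← mul_apply_eq_comp, B.inv_mul, one_apply_eq_self]
      -- On `D(T)` one has `z - T = -z (z⁻¹ - K) T`, whence the resolvent `-z⁻¹ K B⁻¹`.
      refine ⟨-(z⁻¹ • (K * (↑B⁻¹ : E →L[ℂ] E))), fun y => ?_, fun x => ?_⟩
      · obtain ⟨x, hx, hxy⟩ := h₁ (-(z⁻¹ • (↑B⁻¹ : E →L[ℂ] E) y))
        refine ⟨x, ?_, ?_⟩
        · rw [hx]
          simp
        · have := l₁ y
          rw [hB'] at this
          rw [hx, hxy, map_neg, map_smul, smul_neg, smul_inv_smul₀ hz0, sub_neg_eq_add,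
            neg_add_eq_sub, this]
      · have e : z • (x : E) - T x = (B : E →L[ℂ] E) (-(z • T x)) := by
          rw [hB', map_neg, map_smul, h₂, smul_neg, inv_smul_smul₀ hz0]
          abel
        rw [e]
        simp [l₂, h₂, smul_smul, hz0]
  · rintro ⟨x, hx, hxz⟩ ⟨R, -, hR⟩
    have := hR x
    rw [hxz, sub_self, map_zero] at this
    exact hx this.symm

/-! The inverse of `A` -/

lemma _root_.IsCompactOperator.prodMk {E F G : Type*} [NormedAddCommGroup E] [NormedSpace ℂ E]
    [NormedAddCommGroup F] [NormedSpace ℂ F] [NormedAddCommGroup G] [NormedSpace ℂ G]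
    {f : E →L[ℂ] F} {g : E →L[ℂ] G} (hf : IsCompactOperator f) (hg : IsCompactOperator g) :
    IsCompactOperator (f.prod g) := by
  have h := (hf.clm_comp (ContinuousLinearMap.inl ℂ F G)).add
    (hg.clm_comp (ContinuousLinearMap.inr ℂ F G))
  have e : ⇑(f.prod g) = ⇑(ContinuousLinearMap.inl ℂ F G) ∘ ⇑f +
      ⇑(ContinuousLinearMap.inr ℂ F G) ∘ ⇑g := by
    funext x
    simp
  rwa [e]

/-- The Hilbert space of all `(u', v, w, ũ', ṽ)`. -/
abbrev EnergySpace : Type := L2 0 1 × L2 0 1 × L2 1 2 × L2 2 3 × L2 2 3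

lemma isWeakDeriv_volterra_sub_total {a b : ℝ} (hab : a ≤ b) (g : L2 a b) :
    IsWeakDeriv (volterra a b g + constL2 a b (-total a b g)) g := by
  simpa using (isWeakDeriv_volterra hab g).add (isWeakDeriv_constL2 hab (-total a b g))

lemma hasValue_volterra_left {a b : ℝ} (hab : a ≤ b) (g : L2 a b) :
    HasValue (volterra a b g) a 0 := by
  simpa [hab] using hasValue_volterra g a

lemma hasValue_volterra_right {a b : ℝ} (g : L2 a b) :
    HasValue (volterra a b g) b (total a b g) := hasValue_volterra g b

lemma hasValue_volterra_sub_total_right {a b : ℝ} (g : L2 a b) :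
    HasValue (volterra a b g + constL2 a b (-total a b g)) b 0 := by
  simpa using (hasValue_volterra_right g).add (hasValue_constL2 (-total a b g) b)

lemma hasValue_volterra_sub_total_left {a b : ℝ} (hab : a ≤ b) (g : L2 a b) :
    HasValue (volterra a b g + constL2 a b (-total a b g)) a (-total a b g) := by
  simpa using (hasValue_volterra_left hab g).add (hasValue_constL2 (-total a b g) a)

/-- The element of `X` with given `(u', v, w, ũ', ṽ)`. -/
def ofEnergy (y : EnergySpace) : X :=
  X.mk (volterra 0 1 y.1) y.2.1 y.2.2.1
    (volterra 2 3 y.2.2.2.1 + constL2 2 3 (-total 2 3 y.2.2.2.1)) y.2.2.2.2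
    ⟨_, isWeakDeriv_volterra zero_le_one _⟩
    ⟨_, isWeakDeriv_volterra_sub_total (by norm_num) _⟩
    (hasValue_volterra_left zero_le_one _) (hasValue_volterra_sub_total_right _)

lemma wd_ofEnergy_u (y : EnergySpace) : wd (ofEnergy y).u = y.1 :=
  (isWeakDeriv_volterra zero_le_one y.1).wd_eq

lemma wd_ofEnergy_ut (y : EnergySpace) : wd (ofEnergy y).ut = y.2.2.2.1 :=
  (isWeakDeriv_volterra_sub_total (by norm_num) y.2.2.2.1).wd_eq

/-- The condition `u(0) = 0` fixes the constant of integration. This and the analogue for `ũ(3) = 0`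
let `energyEquiv` trade `u`, `ũ` for arbitrary `L²` derivatives. -/
lemma u_eq_volterra (x : X) : x.u = volterra 0 1 (wd x.u) := by
  have h := (isWeakDeriv_wd x.u_mem).eq_of_hasValue one_pos (p := 0) (by norm_num) x.u_zero
  rwa [prim_left zero_le_one, sub_zero, map_zero, add_zero] at h

lemma ut_eq_volterra (x : X) :
    x.ut = volterra 2 3 (wd x.ut) + constL2 2 3 (-total 2 3 (wd x.ut)) := by
  have h := (isWeakDeriv_wd x.ut_mem).eq_of_hasValue (by norm_num) (p := 3) (by norm_num)
    x.ut_three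
  rwa [zero_sub] at h

lemma norm_components_le (x : X) : ‖wd x.u‖ ≤ ‖x‖ ∧ ‖x.v‖ ≤ ‖x‖ ∧ ‖x.w‖ ≤ ‖x‖ ∧
    ‖wd x.ut‖ ≤ ‖x‖ ∧ ‖x.vt‖ ≤ ‖x‖ := by
  have h := X.norm_sq x
  have h1 := sq_nonneg ‖wd x.u‖
  have h2 := sq_nonneg ‖x.v‖
  have h3 := sq_nonneg ‖x.w‖
  have h4 := sq_nonneg ‖wd x.ut‖
  have h5 := sq_nonneg ‖x.vt‖
  refine ⟨?_, ?_, ?_, ?_, ?_⟩ <;>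
    exact (sq_le_sq₀ (norm_nonneg _) (norm_nonneg _)).1 (by linarith)

/-- `x ↦ (u', v, w, ũ', ṽ)` is an isomorphism of `X` onto a product of `L²` spaces. -/
def energyEquiv : X ≃L[ℂ] EnergySpace :=
  LinearEquiv.toContinuousLinearEquivOfBounds
    { toFun := fun x => (wd x.u, x.v, x.w, wd x.ut, x.vt)
      map_add' := fun x y => by
        simp only [X.add_u, X.add_v, X.add_w, X.add_ut, X.add_vt, X.wd_add_u, X.wd_add_ut]
        rfl
      map_smul' := fun c x => by
        simp only [X.smul_u, X.smul_v, X.smul_w, X.smul_ut, X.smul_vt, X.wd_smul_u, X.wd_smul_ut]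
        rfl
      invFun := ofEnergy
      left_inv := fun x => X.ext (u_eq_volterra x).symm rfl rfl (ut_eq_volterra x).symm rfl
      right_inv := fun y => Prod.ext (wd_ofEnergy_u y) (Prod.ext rfl (Prod.ext rfl
        (Prod.ext (wd_ofEnergy_ut y) rfl))) }
    -- The product carries the maximum norm, so the energy norm squared is a sum of five squares
    -- bounded by `5 ‖y‖² ≤ (3 ‖y‖)²`.
    1 3
    (fun x => by
      obtain ⟨h1, h2, h3, h4, h5⟩ := norm_components_le x
      rw [one_mul]
      exact norm_prod_le_iff.2 ⟨h1, norm_prod_le_iff.2 ⟨h2, norm_prod_le_iff.2 ⟨h3,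
        norm_prod_le_iff.2 ⟨h4, h5⟩⟩⟩⟩)
    (fun y => by
      have h : ‖ofEnergy y‖ ^ 2 = ‖y.1‖ ^ 2 + ‖y.2.1‖ ^ 2 + ‖y.2.2.1‖ ^ 2 + ‖y.2.2.2.1‖ ^ 2
          + ‖y.2.2.2.2‖ ^ 2 := by
        rw [X.norm_sq, wd_ofEnergy_u, wd_ofEnergy_ut]
        rfl
      obtain ⟨h1, k1⟩ := norm_prod_le_iff.1 (le_refl ‖y‖)
      obtain ⟨h2, k2⟩ := norm_prod_le_iff.1 k1
      obtain ⟨h3, k3⟩ := norm_prod_le_iff.1 k2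
      obtain ⟨h4, h5⟩ := norm_prod_le_iff.1 k3
      have s1 := pow_le_pow_left₀ (norm_nonneg _) h1 2
      have s2 := pow_le_pow_left₀ (norm_nonneg _) h2 2
      have s3 := pow_le_pow_left₀ (norm_nonneg _) h3 2
      have s4 := pow_le_pow_left₀ (norm_nonneg _) h4 2
      have s5 := pow_le_pow_left₀ (norm_nonneg _) h5 2
      change ‖ofEnergy y‖ ≤ 3 * ‖y‖
      refine (sq_le_sq₀ (norm_nonneg _) (by positivity)).1 ?_
      rw [h, mul_pow]
      linarith [sq_nonneg ‖y‖])

/-- Completeness is inherited from the `L²` spaces; the Fredholm alternative requires it. -/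
instance : CompleteSpace X := (completeSpace_congr (e := energyEquiv.toEquiv) energyEquiv.isUniformEmbedding).2 inferInstance

/-- The flux `u'(1) = w'(1)` of the solution of `A x = y`. -/
def fluxOne : EnergySpace →L[ℂ] ℂ :=
  -(total 2 3 ∘L .fst ℂ _ _ ∘L .snd ℂ _ _ ∘L .snd ℂ _ _ ∘L .snd ℂ _ _) - total 0 1 ∘L .fst ℂ _ _
    - total 1 2 ∘L volterra 1 2 ∘L .fst ℂ _ _ ∘L .snd ℂ _ _ ∘L .snd ℂ _ _

lemma fluxOne_apply (y : EnergySpace) : fluxOne y =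
    -total 2 3 y.2.2.2.1 - total 0 1 y.1 - total 1 2 (volterra 1 2 y.2.2.1) := rfl


lemma isCompactOperator_constL2_comp {E : Type*} [NormedAddCommGroup E] [NormedSpace ℂ E]
    {a b : ℝ} (f : E →L[ℂ] ℂ) : IsCompactOperator (constL2 a b ∘L f) := by
  have h : IsCompactOperator f := isCompactOperator_of_locallyCompactSpace_dom f
  exact h.clm_comp (constL2 a b)

lemma isCompactOperator_volterra_comp {E : Type*} [NormedAddCommGroup E] [NormedSpace ℂ E]
    {a b : ℝ} (f : E →L[ℂ] L2 a b) : IsCompactOperator (volterra a b ∘L f) :=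
  (isCompactOperator_volterra a b).comp_clm f

/-- `A⁻¹` in terms of the components `(u', v, w, ũ', ṽ)`. -/
def inverseEnergy : EnergySpace →L[ℂ] EnergySpace :=
  (constL2 0 1 ∘L (fluxOne - total 0 1 ∘L .fst ℂ _ _ ∘L .snd ℂ _ _) +
      volterra 0 1 ∘L .fst ℂ _ _ ∘L .snd ℂ _ _).prod <|
    (volterra 0 1 ∘L .fst ℂ _ _).prod <|
    (volterra 1 2 ∘L (constL2 1 2 ∘L fluxOne +
        volterra 1 2 ∘L .fst ℂ _ _ ∘L .snd ℂ _ _ ∘L .snd ℂ _ _) +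
      constL2 1 2 ∘L total 0 1 ∘L .fst ℂ _ _).prod <|
    (constL2 2 3 ∘L (fluxOne + total 1 2 ∘L .fst ℂ _ _ ∘L .snd ℂ _ _ ∘L .snd ℂ _ _) +
      volterra 2 3 ∘L .snd ℂ _ _ ∘L .snd ℂ _ _ ∘L .snd ℂ _ _ ∘L .snd ℂ _ _).prod
    (volterra 2 3 ∘L .fst ℂ _ _ ∘L .snd ℂ _ _ ∘L .snd ℂ _ _ ∘L .snd ℂ _ _ +
      constL2 2 3 ∘L (-(total 2 3 ∘L .fst ℂ _ _ ∘L .snd ℂ _ _ ∘L .snd ℂ _ _ ∘L .snd ℂ _ _)))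

lemma isCompactOperator_inverseEnergy : IsCompactOperator inverseEnergy := by
  refine IsCompactOperator.prodMk ?_ (IsCompactOperator.prodMk ?_ (IsCompactOperator.prodMk ?_
    (IsCompactOperator.prodMk ?_ ?_)))
  · exact (isCompactOperator_constL2_comp _).add (isCompactOperator_volterra_comp _)
  · exact isCompactOperator_volterra_comp _
  · exact (isCompactOperator_volterra_comp _).add (isCompactOperator_constL2_comp (_ ∘L _))
  · exact (isCompactOperator_constL2_comp _).add (isCompactOperator_volterra_comp _)
  · exact (isCompactOperator_volterra_comp _).add (isCompactOperator_constL2_comp _)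

/-- The inverse of `A`. -/
def inverseA : X →L[ℂ] X :=
  (energyEquiv.symm : EnergySpace →L[ℂ] X) ∘L inverseEnergy ∘L (energyEquiv : X →L[ℂ] EnergySpace)

lemma isCompactOperator_inverseA : IsCompactOperator inverseA :=
  (isCompactOperator_inverseEnergy.comp_clm (energyEquiv : X →L[ℂ] EnergySpace)).clm_comp
    (energyEquiv.symm : EnergySpace →L[ℂ] X)

lemma total_constL2 {a b : ℝ} (hab : a ≤ b) (k : ℂ) :
    total a b (constL2 a b k) = (b - a : ℝ) * k := by
  rw [total_apply, prim_eq_of_ae ⟨hab, le_rfl⟩ (constL2_ae k)]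
  simp

lemma isWeakDeriv_const_add_volterra {a b : ℝ} (hab : a ≤ b) (k : ℂ) (g : L2 a b) :
    IsWeakDeriv (constL2 a b k + volterra a b g) g := by
  simpa using (isWeakDeriv_constL2 hab k).add (isWeakDeriv_volterra hab g)

lemma hasValue_const_add_volterra_left {a b : ℝ} (hab : a ≤ b) (k : ℂ) (g : L2 a b) :
    HasValue (constL2 a b k + volterra a b g) a k := by
  simpa using (hasValue_constL2 k a).add (hasValue_volterra_left hab g)

lemma hasValue_const_add_volterra_right {a b : ℝ} (k : ℂ) (g : L2 a b) :
    HasValue (constL2 a b k + volterra a b g) b (k + total a b g) :=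
  (hasValue_constL2 k b).add (hasValue_volterra_right g)

lemma inDomain_inverseA (x : X) :
    ∃ h : InDomain (inverseA x), act (inverseA x) h = x := by
  set y : EnergySpace := (wd x.u, x.v, x.w, wd x.ut, x.vt)
  have hu : wd (inverseA x).u = constL2 0 1 (fluxOne y - total 0 1 x.v) + volterra 0 1 x.v :=
    wd_ofEnergy_u _
  have hut : wd (inverseA x).ut =
      constL2 2 3 (fluxOne y + total 1 2 x.w) + volterra 2 3 x.vt := wd_ofEnergy_ut _
  have hv : (inverseA x).v = x.u := (u_eq_volterra x).symm
  have hvt : (inverseA x).vt = x.ut := (ut_eq_volterra x).symm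
  have hw : (inverseA x).w = volterra 1 2 (constL2 1 2 (fluxOne y) + volterra 1 2 x.w) +
      constL2 1 2 (total 0 1 (wd x.u)) := rfl
  have dw : IsWeakDeriv (inverseA x).w (constL2 1 2 (fluxOne y) + volterra 1 2 x.w) := by
    rw [hw, add_comm]
    exact isWeakDeriv_const_add_volterra (by norm_num) _ _
  have ddu : IsWeakDeriv (wd (inverseA x).u) x.v := by
    rw [hu]
    exact isWeakDeriv_const_add_volterra zero_le_one _ _
  have ddut : IsWeakDeriv (wd (inverseA x).ut) x.vt := by
    rw [hut]
    exact isWeakDeriv_const_add_volterra (by norm_num) _ _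
  have ddw : IsWeakDeriv (wd (inverseA x).w) x.w := by
    rw [dw.wd_eq]
    exact isWeakDeriv_const_add_volterra (by norm_num) _ _
  have h : InDomain (inverseA x) :=
    { u_mem := ⟨(inverseA x).u_mem, _, ddu⟩
      v_mem := by rw [hv]; exact x.u_mem
      w_mem := ⟨⟨_, dw⟩, _, ddw⟩
      ut_mem := ⟨(inverseA x).ut_mem, _, ddut⟩
      vt_mem := by rw [hvt]; exact x.ut_mem
      v_zero := by rw [hv]; exact x.u_zero
      vt_three := by rw [hvt]; exact x.ut_three
      flux_one := by
        refine ⟨fluxOne y, ?_, ?_⟩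
        · rw [hu]
          simpa using hasValue_const_add_volterra_right (fluxOne y - total 0 1 x.v) x.v
        · rw [dw.wd_eq]
          exact hasValue_const_add_volterra_left (by norm_num) _ _
      value_one := by
        refine ⟨total 0 1 (wd x.u), ?_, ?_⟩
        · have := hasValue_volterra_right (wd x.u)
          rw [← u_eq_volterra x] at this
          rwa [hv]
        · rw [hw, add_comm]
          exact hasValue_const_add_volterra_left (by norm_num) _ _
      flux_two := by
        refine ⟨fluxOne y + total 1 2 x.w, ?_, ?_⟩
        · rw [hut]
          exact hasValue_const_add_volterra_left (by norm_num) _ _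
        · rw [dw.wd_eq]
          exact hasValue_const_add_volterra_right _ _
      value_two := by
        -- The other conditions hold by the choice of the constants of integration. This one is the
        -- equation that `fluxOne` solves; the interval `(1,2)` has length 1, so the flux enters it
        -- with coefficient 1.
        refine ⟨-total 2 3 (wd x.ut), ?_, ?_⟩
        · have := hasValue_volterra_sub_total_left (by norm_num : (2 : ℝ) ≤ 3) (wd x.ut)
          rw [← ut_eq_volterra x] at this
          rwa [hvt]
        · have := hasValue_const_add_volterra_right (total 0 1 (wd x.u))
            (constL2 1 2 (fluxOne y) + volterra 1 2 x.w)
          rw [add_comm, ← hw] at this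
          convert this using 1
          rw [map_add, total_constL2 (by norm_num), fluxOne_apply]
          push_cast
          ring }
  refine ⟨h, X.ext ?_ ?_ ?_ ?_ ?_⟩
  · rw [act_u, hv]
  · rw [act_v, ddu.wd_eq]
  · rw [act_w, ddw.wd_eq]
  · rw [act_ut, hvt]
  · rw [act_vt, ddut.wd_eq]

/-- Here `v = ṽ = 0`, so the affine function `w` vanishes at 1 and 2 and is zero. Then both fluxes
vanish, which kills the constants `u'` and `ũ'`, and the outer boundary conditions kill `u` and `ũ`.
-/
lemma eq_zero_of_act_eq_zero {x : X} (hx : InDomain x) (h : act x hx = 0) : x = 0 := by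
  have hv : x.v = 0 := by rw [← act_u x hx, h, X.zero_u]
  have hvt : x.vt = 0 := by rw [← act_ut x hx, h, X.zero_ut]
  have hu : wd (wd x.u) = 0 := by rw [← act_v x hx, h, X.zero_v]
  have hut : wd (wd x.ut) = 0 := by rw [← act_vt x hx, h, X.zero_vt]
  have hw : wd (wd x.w) = 0 := by rw [← act_w x hx, h, X.zero_w]
  have w1 : HasValue x.w 1 0 := by
    obtain ⟨z, h1, h2⟩ := hx.value_one
    rw [hv] at h1
    rwa [← h1.unique one_pos (by norm_num) HasValue.zero]
  have w2 : HasValue x.w 2 0 := by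
    obtain ⟨z, h1, h2⟩ := hx.value_two
    rw [hvt] at h1
    rwa [← h1.unique (by norm_num) (by norm_num) HasValue.zero]
  obtain ⟨k, hk⟩ : ∃ k, wd x.w = constL2 1 2 k := by
    have := isWeakDeriv_wd hx.w_mem.2
    rw [hw] at this
    simpa using this.eq_volterra_add_const (by norm_num)
  have hxw : x.w = volterra 1 2 (constL2 1 2 k) := by
    have := (isWeakDeriv_wd hx.w_mem.1).eq_of_hasValue (by norm_num) (by norm_num) w1
    rwa [hk, prim_left (by norm_num), sub_zero, map_zero, add_zero] at this
  have hk0 : k = 0 := by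
    have := hasValue_volterra_right (constL2 1 2 k)
    rw [← hxw] at this
    have := this.unique (by norm_num) (by norm_num) w2
    rw [total_constL2 (by norm_num)] at this
    norm_num at this
    exact this
  have hdw : wd x.w = 0 := by rw [hk, hk0, map_zero]
  have hdu : wd x.u = 0 := by
    obtain ⟨z, h1, h2⟩ := hx.flux_one
    rw [hdw] at h2
    rw [h2.unique (by norm_num) (by norm_num) HasValue.zero] at h1
    exact eq_zero_of_wd_eq_zero one_pos (by norm_num) hx.u_mem.2 hu h1
  have hdut : wd x.ut = 0 := by
    obtain ⟨z, h1, h2⟩ := hx.flux_two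
    rw [hdw] at h2
    rw [h2.unique (by norm_num) (by norm_num) HasValue.zero] at h1
    exact eq_zero_of_wd_eq_zero (by norm_num) (by norm_num) hx.ut_mem.2 hut h1
  refine X.ext ?_ hv ?_ ?_ hvt
  · rw [u_eq_volterra x, hdu, map_zero, X.zero_u]
  · rw [hxw, hk0, map_zero, map_zero, X.zero_w]
  · rw [ut_eq_volterra x, hdut, map_zero, map_zero, neg_zero, map_zero, add_zero, X.zero_ut]

lemma exists_A_eq (y : X) : ∃ x : A.domain, (x : X) = inverseA y ∧ A x = y := by
  obtain ⟨h, h'⟩ := inDomain_inverseA y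
  exact ⟨⟨_, h⟩, rfl, h'⟩

/-- A right inverse of an injective operator is also a left inverse. -/
lemma inverseA_A (x : A.domain) : inverseA (A x) = x := by
  obtain ⟨x', h1, h2⟩ := exists_A_eq (A x)
  have h3 : A (x' - x) = 0 := by rw [LinearPMap.map_sub, h2, sub_self]
  have h4 : ((x' - x : A.domain) : X) = 0 := eq_zero_of_act_eq_zero (x' - x).2 h3
  rw [← h1]
  exact sub_eq_zero.1 h4

lemma mem_spec_A_iff (z : ℂ) : z ∈ spec A ↔ IsEigenvalue A z :=
  mem_spec_iff_isEigenvalue_of_compact_inverse isCompactOperator_inverseA exists_A_eq inverseA_A z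

lemma zero_notMem_spec_A : (0 : ℂ) ∉ spec A := fun h =>
  h (inResolventSet_zero_of_inverse exists_A_eq inverseA_A)

/-! The zeros of the determinant -/

lemma csqrt_sq (z : ℂ) : csqrt z ^ 2 = z := by
  rw [csqrt, one_div]
  exact Complex.cpow_nat_inv_pow z two_ne_zero

/-- The entire function with `det M_z = -z² charFun √z`. -/
def charFun (s : ℂ) : ℂ :=
  2 * s * Complex.sinh (s ^ 2) * Complex.cosh (s ^ 2) * Complex.cosh s
    + s ^ 2 * Complex.sinh (s ^ 2) ^ 2 * Complex.sinh s + Complex.cosh (s ^ 2) ^ 2 * Complex.sinh s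

lemma det_M (z : ℂ) : (M z).det = -z ^ 2 * charFun (csqrt z) := by
  have h : (M z).det = -(z ^ 2 * Complex.sinh z * csqrt z * Complex.cosh (csqrt z)
      * Complex.cosh z * 2) - z ^ 2 * Complex.sinh z ^ 2 * csqrt z ^ 2 * Complex.sinh (csqrt z) -
      z ^ 2 * Complex.cosh z ^ 2 * Complex.sinh (csqrt z) := by
    rw [M]
    simp [Matrix.det_succ_row_zero, Fin.sum_univ_succ, Fin.succAbove]
    ring
  rw [h, charFun, csqrt_sq]
  ring

lemma charFun_neg (s : ℂ) : charFun (-s) = -charFun s := by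
  simp only [charFun, neg_sq, Complex.cosh_neg, Complex.sinh_neg]
  ring

/-- The factorization of `charFun` into the parts belonging to the states which are symmetric
and antisymmetric about the midpoint. -/
lemma charFun_eq_mul (s : ℂ) : charFun s =
    2 * (Complex.cosh (s ^ 2) * Complex.cosh (s / 2)
        + Complex.sinh (s ^ 2) * (s * Complex.sinh (s / 2)))
      * (Complex.cosh (s ^ 2) * Complex.sinh (s / 2)
        + Complex.sinh (s ^ 2) * (s * Complex.cosh (s / 2))) := by
  have h1 : Complex.sinh s = 2 * Complex.sinh (s / 2) * Complex.cosh (s / 2) := by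
    rw [← Complex.sinh_two_mul, mul_div_cancel₀ s two_ne_zero]
  have h2 : Complex.cosh s = Complex.cosh (s / 2) ^ 2 + Complex.sinh (s / 2) ^ 2 := by
    rw [← Complex.cosh_two_mul, mul_div_cancel₀ s two_ne_zero]
  rw [charFun, h1, h2]
  ring

/-! ### Absence of zeros where `Re s² ≥ 0` -/

lemma re_ofReal_add_mul_I (x y : ℝ) : ((x : ℂ) + y * Complex.I).re = x := by simp

lemma im_ofReal_add_mul_I (x y : ℝ) : ((x : ℂ) + y * Complex.I).im = y := by simp

/-- Add the addition formulas for `sinh` at `z + z̄ = 2 Re z` and `z - z̄ = 2 i Im z`. -/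
lemma sinh_mul_conj_cosh (z : ℂ) : Complex.sinh z * conj (Complex.cosh z) =
    (Real.sinh (2 * z.re) / 2 : ℝ) + (Real.sin (2 * z.im) / 2 : ℝ) * Complex.I := by
  have h1 := Complex.sinh_add z (conj z)
  have h2 := Complex.sinh_sub z (conj z)
  rw [Complex.add_conj] at h1
  rw [Complex.sub_conj, Complex.sinh_mul_I] at h2
  rw [← Complex.cosh_conj]
  push_cast at h1 h2 ⊢
  linear_combination (-1 / 2 : ℂ) * h1 - (1 / 2 : ℂ) * h2

lemma cosh_mul_conj_sinh (z : ℂ) : Complex.cosh z * conj (Complex.sinh z) =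
    (Real.sinh (2 * z.re) / 2 : ℝ) + (-(Real.sin (2 * z.im) / 2) : ℝ) * Complex.I := by
  have h := congrArg conj (sinh_mul_conj_cosh z)
  simp only [map_mul, map_add, Complex.conj_conj, Complex.conj_ofReal, Complex.conj_I] at h
  rw [mul_comm, h, Complex.ofReal_neg]
  ring

/-- If `C a = -S b`, multiplying by the conjugates of `S` and `a` gives `C S̄ |a|² = -|S|² b ā`,
whose sides have real parts of incompatible signs. The hypothesis `hC` excludes `S = 0`. -/
lemma add_ne_zero_of_re_pos {C S a b : ℂ} (hCS : 0 ≤ (C * conj S).re) (hC : S = 0 → C ≠ 0)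
    (hab : 0 < (b * conj a).re) : C * a + S * b ≠ 0 := by
  intro h
  have ha : a ≠ 0 := by
    rintro rfl
    simp at hab
  have hS : S ≠ 0 := by
    rintro rfl
    rw [zero_mul, add_zero] at h
    exact mul_ne_zero (hC rfl) ha h
  have e : (C * conj S) * Complex.normSq a + Complex.normSq S * (b * conj a) = 0 := by
    rw [← Complex.mul_conj, ← Complex.mul_conj]
    linear_combination conj S * conj a * h
  have e' := congrArg Complex.re e
  rw [Complex.add_re, Complex.re_mul_ofReal, Complex.re_ofReal_mul, Complex.zero_re] at e'
  have h1 := Complex.normSq_pos.2 hS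
  have h2 := Complex.normSq_nonneg a
  have h3 := mul_pos h1 hab
  have h4 := mul_nonneg hCS h2
  linarith

lemma sq_lt_mul_sinh {x : ℝ} (hx : x ≠ 0) : x ^ 2 < x * Real.sinh x := by
  rcases hx.lt_or_gt with h | h
  · have := Real.self_lt_sinh_iff.2 (neg_pos.2 h)
    rw [Real.sinh_neg] at this
    nlinarith
  · have := Real.self_lt_sinh_iff.2 h
    nlinarith

lemma abs_mul_sin_le (y : ℝ) : |y * Real.sin y| ≤ y ^ 2 := by
  rw [abs_mul, ← sq_abs, sq]
  exact mul_le_mul_of_nonneg_left Real.abs_sin_le_abs (abs_nonneg y)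

/-- `charFun` has no zeros in the sector `Re s² ≥ 0` apart from the origin. -/
lemma charFun_ne_zero {s : ℂ} (hs : s ≠ 0) (h : 0 ≤ (s ^ 2).re) : charFun s ≠ 0 := by
  have hre : (s ^ 2).re = s.re ^ 2 - s.im ^ 2 := by
    rw [sq, Complex.mul_re]
    ring
  have hsre : s.re ≠ 0 := by
    intro h0
    refine hs (Complex.ext h0 ?_)
    rw [hre, h0] at h
    exact pow_eq_zero_iff two_ne_zero |>.1 (le_antisymm (by linarith) (sq_nonneg _))
  have hlt := sq_lt_mul_sinh hsre
  have hle := abs_le.1 (abs_mul_sin_le s.im)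
  have hC : Complex.sinh (s ^ 2) = 0 → Complex.cosh (s ^ 2) ≠ 0 := fun h0 h1 => by
    have := Complex.cosh_sq_sub_sinh_sq (s ^ 2)
    rw [h0, h1] at this
    norm_num at this
  have hCS : 0 ≤ (Complex.cosh (s ^ 2) * conj (Complex.sinh (s ^ 2))).re := by
    rw [cosh_mul_conj_sinh]
    rw [re_ofReal_add_mul_I]
    linarith [Real.sinh_nonneg_iff.2 (by linarith : 0 ≤ 2 * (s ^ 2).re)]
  have hre2 : 2 * (s / 2).re = s.re := by
    rw [Complex.div_ofNat_re]; ring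
  have him2 : 2 * (s / 2).im = s.im := by
    rw [Complex.div_ofNat_im]; ring
  rw [charFun_eq_mul]
  refine mul_ne_zero (mul_ne_zero two_ne_zero (add_ne_zero_of_re_pos hCS hC ?_))
    (add_ne_zero_of_re_pos hCS hC ?_)
  -- With `s = x + iy` the real part is `(x sinh x - y sin y)/2`, and `|y sin y| ≤ y² ≤ x² < x sinh
  -- x`. The other factor has the opposite sign of `y sin y`.
  · rw [mul_assoc, sinh_mul_conj_cosh, hre2, him2, Complex.mul_re, re_ofReal_add_mul_I,
      im_ofReal_add_mul_I]
    linarith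
  · rw [mul_assoc, cosh_mul_conj_sinh, hre2, him2, Complex.mul_re, re_ofReal_add_mul_I,
      im_ofReal_add_mul_I]
    linarith

lemma det_M_ne_zero {z : ℂ} (hz : z ≠ 0) (h : 0 ≤ z.re) : (M z).det ≠ 0 := by
  rw [det_M]
  refine mul_ne_zero (neg_ne_zero.2 (pow_ne_zero 2 hz)) (charFun_ne_zero ?_ (by rwa [csqrt_sq]))
  intro h0
  have := csqrt_sq z
  rw [h0] at this
  exact hz (by rw [← this]; ring)

/-! ### Isolation of the zeros -/

lemma analyticOnNhd_charFun : AnalyticOnNhd ℂ charFun univ := by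
  refine Complex.analyticOnNhd_univ_iff_differentiable.2 ?_
  unfold charFun
  fun_prop

/-- The identity theorem applies because `charFun 1 ≠ 0`. -/
lemma exists_isolating_charFun (s : ℂ) :
    ∃ δ > 0, ∀ t, charFun t = 0 → dist t s < δ → t = s := by
  have h : ¬ ∃ᶠ t in 𝓝[≠] s, charFun t = 0 := fun hf =>
    charFun_ne_zero one_ne_zero (by norm_num)
      (analyticOnNhd_charFun.eqOn_zero_of_preconnected_of_frequently_eq_zero isPreconnected_univ
        (mem_univ s) hf (mem_univ 1))
  rw [Filter.not_frequently, eventually_nhdsWithin_iff, Metric.eventually_nhds_iff] at h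
  obtain ⟨δ, hδ, h⟩ := h
  exact ⟨δ, hδ, fun t ht hts => by_contra fun hne => h hts hne ht⟩

/-- The nonzero zeros of `det M_z` are isolated. -/
lemma exists_isolating_det_M (z : ℂ) :
    ∃ ε > 0, ∀ z', z' ≠ 0 → (M z').det = 0 → dist z' z < ε → z' = z := by
  obtain ⟨δ, hδ, h⟩ := exists_isolating_charFun (csqrt z)
  refine ⟨δ ^ 2, by positivity, fun z' hz' hdet hd => ?_⟩
  have h0 : charFun (csqrt z') = 0 := by
    rw [det_M] at hdet
    exact (mul_eq_zero.1 hdet).resolve_left (neg_ne_zero.2 (pow_ne_zero 2 hz'))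
  -- Since `z' - z = (√z' - √z)(√z' + √z)`, a distance below `δ²` puts `√z'` or `-√z'` within `δ` of
  -- `√z`. Both are zeros of the odd function `charFun`, so continuity of the square root is not
  -- needed.
  have e : dist z' z = dist (csqrt z') (csqrt z) * dist (-csqrt z') (csqrt z) := by
    rw [dist_eq_norm, dist_eq_norm, dist_eq_norm, ← norm_mul, ← norm_neg]
    congr 1
    linear_combination csqrt_sq z' - csqrt_sq z
  rw [← csqrt_sq z', ← csqrt_sq z]
  rcases lt_or_ge (dist (csqrt z') (csqrt z)) δ with h1 | h1
  · rw [h _ h0 h1]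
  · have h2 : dist (-csqrt z') (csqrt z) < δ := by
      by_contra! h2
      have := mul_le_mul h1 h2 hδ.le dist_nonneg
      rw [← e, ← sq] at this
      linarith
    rw [← h _ (by rw [charFun_neg, h0, neg_zero]) h2, neg_sq]

/-! Solutions of `f'' = μ² f` -/

lemma hasDerivAt_ofReal (x : ℝ) : HasDerivAt (fun x : ℝ => (x : ℂ)) 1 x :=
  (hasDerivAt_id (x : ℂ)).comp_ofReal

/-- The function `x ↦ α cosh (μ (x - p)) + β sinh (μ (x - p))` in `L²(a,b)`. -/
def hyp (a b : ℝ) (μ : ℂ) (p : ℝ) (α β : ℂ) : L2 a b :=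
  ofCont a b (fun x => α * Complex.cosh (μ * (x - p)) + β * Complex.sinh (μ * (x - p)))
    (by fun_prop)

section
variable {a b : ℝ} {μ : ℂ} {p : ℝ} {α β : ℂ}

lemma hasValue_hyp (x : ℝ) : HasValue (hyp a b μ p α β) x
    (α * Complex.cosh (μ * (x - p)) + β * Complex.sinh (μ * (x - p))) :=
  hasValue_ofCont _ x

lemma hasValue_hyp_self : HasValue (hyp a b μ p α β) p α := by
  simpa using hasValue_hyp (a := a) (b := b) (μ := μ) (p := p) (α := α) (β := β) p

lemma smul_hyp (k : ℂ) : k • hyp a b μ p α β = hyp a b μ p (k * α) (k * β) := by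
  refine Lp.ext ?_
  have h : Continuous fun x : ℝ =>
      α * Complex.cosh (μ * (x - p)) + β * Complex.sinh (μ * (x - p)) := by fun_prop
  have h' : Continuous fun x : ℝ =>
      (k * α) * Complex.cosh (μ * (x - p)) + (k * β) * Complex.sinh (μ * (x - p)) := by fun_prop
  filter_upwards [Lp.coeFn_smul k (hyp a b μ p α β), ofCont_ae (a := a) (b := b) h,
    ofCont_ae (a := a) (b := b) h'] with x h1 h2 h3
  rw [h1, Pi.smul_apply, hyp, h2, hyp, h3, smul_eq_mul]
  ring

lemma isWeakDeriv_hyp (hab : a ≤ b) :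
    IsWeakDeriv (hyp a b μ p α β) (hyp a b μ p (μ * β) (μ * α)) := by
  refine isWeakDeriv_of_hasDerivAt hab (fun x _ => ?_) ?_ (ofCont_ae _) (ofCont_ae _)
  · have h : HasDerivAt (fun x : ℝ => μ * ((x : ℂ) - p)) μ x := by
      simpa using ((hasDerivAt_ofReal x).sub_const (p : ℂ)).const_mul μ
    exact ((((Complex.hasDerivAt_cosh _).comp x h).const_mul α).add
      (((Complex.hasDerivAt_sinh _).comp x h).const_mul β)).congr_deriv (by ring)
  · fun_prop

lemma wd_hyp (hab : a ≤ b) : wd (hyp a b μ p α β) = hyp a b μ p (μ * β) (μ * α) :=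
  (isWeakDeriv_hyp hab).wd_eq

lemma hyp_mem_H1 (hab : a ≤ b) : hyp a b μ p α β ∈ H1 a b := ⟨_, isWeakDeriv_hyp hab⟩

lemma hyp_mem_H2 (hab : a ≤ b) : hyp a b μ p α β ∈ H2 a b :=
  ⟨hyp_mem_H1 hab, by rw [wd_hyp hab]; exact hyp_mem_H1 hab⟩

lemma wd_wd_hyp (hab : a ≤ b) : wd (wd (hyp a b μ p α β)) = μ ^ 2 • hyp a b μ p α β := by
  rw [wd_hyp hab, wd_hyp hab, smul_hyp]
  congr 1 <;> ring

end

lemma ae_eq_smul {a b : ℝ} {f : L2 a b} {c : ℝ → ℂ} (k : ℂ)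
    (h : f =ᵐ[volume.restrict (Ioo a b)] c) :
    (k • f : L2 a b) =ᵐ[volume.restrict (Ioo a b)] fun x => k * c x := by
  filter_upwards [Lp.coeFn_smul k f, h] with x h1 h2
  rw [h1, Pi.smul_apply, h2, smul_eq_mul]

/-- `(c, d)` are the continuous representatives of `f` and `f'` for a solution `f` of
`f'' = μ² f` on `(a,b)`. -/
structure IsSolution {a b : ℝ} (μ : ℂ) (f : L2 a b) (c d : ℝ → ℂ) : Prop where
  ae_eq : f =ᵐ[volume.restrict (Ioo a b)] c
  ae_eq_wd : wd f =ᵐ[volume.restrict (Ioo a b)] d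
  hasDerivAt : ∀ x ∈ Icc a b, HasDerivAt c (d x) x
  hasDerivAt' : ∀ x ∈ Icc a b, HasDerivAt d (μ ^ 2 * c x) x

lemma exists_isSolution {a b : ℝ} (hab : a < b) {μ : ℂ} {f : L2 a b} (hf : f ∈ H2 a b)
    (h : wd (wd f) = μ ^ 2 • f) : ∃ c d, IsSolution μ f c d := by
  obtain ⟨k, hk⟩ := (isWeakDeriv_wd hf.1).eq_volterra_add_const hab
  have hc₀ : Continuous fun x => prim (wd f) x + k := (continuous_prim _).add continuous_const
  have hfc₀ : f =ᵐ[volume.restrict (Ioo a b)] fun x => prim (wd f) x + k := by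
    filter_upwards [Lp.coeFn_add (volterra a b (wd f)) (constL2 a b k), volterra_ae (wd f),
      constL2_ae (a := a) (b := b) k] with x h1 h2 h3
    rw [← hk] at h1
    rw [h1, Pi.add_apply, h2, h3]
  -- Bootstrapping: `f` has a continuous representative, so `f'' = μ² f` is continuous, `f'` has a
  -- differentiable representative `d`, and then `f` has a representative with derivative `d`.
  obtain ⟨d, hd, hd'⟩ := (isWeakDeriv_wd hf.2).exists_hasDerivAt hab
    (continuous_const.mul hc₀).continuousOn (by rw [h]; exact ae_eq_smul (μ ^ 2) hfc₀)
  have hdc : ContinuousOn d (Icc a b) := fun x hx => (hd' x hx).continuousAt.continuousWithinAt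
  obtain ⟨c, hc, hc'⟩ := (isWeakDeriv_wd hf.1).exists_hasDerivAt hab hdc hd
  have hcc : ContinuousOn c (Icc a b) := fun x hx => (hc' x hx).continuousAt.continuousWithinAt
  have heq := eqOn_Icc_of_ae_eq hab hcc hc₀.continuousOn (hc.symm.trans hfc₀)
  exact ⟨c, d, hc, hd, hc', fun x hx => by rw [heq hx]; exact hd' x hx⟩

namespace IsSolution
variable {a b : ℝ} {μ : ℂ} {f : L2 a b} {c d : ℝ → ℂ}

lemma continuousOn (h : IsSolution μ f c d) : ContinuousOn c (Icc a b) :=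
  fun x hx => (h.hasDerivAt x hx).continuousAt.continuousWithinAt

lemma continuousOn' (h : IsSolution μ f c d) : ContinuousOn d (Icc a b) :=
  fun x hx => (h.hasDerivAt' x hx).continuousAt.continuousWithinAt

lemma neg (h : IsSolution μ f c d) : IsSolution (-μ) f c d :=
  ⟨h.ae_eq, h.ae_eq_wd, h.hasDerivAt, by simpa only [neg_sq] using h.hasDerivAt'⟩

/-- The function `g = f' + μ f` satisfies `g' = μ g`. Using this for `μ` and for `-μ` separates `f'`
from `μ f` without dividing by `μ`. -/
lemma add_eq_exp (h : IsSolution μ f c d) {x p : ℝ} (hx : x ∈ Icc a b) (hp : p ∈ Icc a b) :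
    d x + μ * c x = Complex.exp (μ * (x - p)) * (d p + μ * c p) := by
  have hE : ∀ x ∈ Icc a b,
      HasDerivAt (fun x : ℝ => Complex.exp (-μ * x) * (d x + μ * c x)) 0 x := by
    intro x hx
    have h1 : HasDerivAt (fun x : ℝ => -μ * (x : ℂ)) (-μ) x := by
      have := (hasDerivAt_ofReal x).const_mul (-μ)
      rwa [mul_one] at this
    refine (((Complex.hasDerivAt_exp _).comp x h1).mul
      ((h.hasDerivAt' x hx).add ((h.hasDerivAt x hx).const_mul μ))).congr_deriv ?_
    simp only [Function.comp_apply, Pi.add_apply]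
    ring
  have hconst := constant_of_has_deriv_right_zero
    (fun x hx => (hE x hx).continuousAt.continuousWithinAt)
    (fun x hx => (hE x (Ico_subset_Icc_self hx)).hasDerivWithinAt)
  have e := (hconst x hx).trans (hconst p hp).symm
  have e1 : Complex.exp (μ * (x - p)) = Complex.exp (μ * x) * Complex.exp (-μ * p) := by
    rw [← Complex.exp_add, neg_mul, mul_sub, sub_eq_add_neg]
  have e2 : Complex.exp (μ * x) * Complex.exp (-μ * x) = 1 := by
    rw [← Complex.exp_add, neg_mul, add_neg_cancel, Complex.exp_zero]
  rw [e1, mul_assoc, ← e, ← mul_assoc, e2, one_mul]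

lemma deriv_eq (h : IsSolution μ f c d) {x p : ℝ} (hx : x ∈ Icc a b) (hp : p ∈ Icc a b) :
    d x = Complex.cosh (μ * (x - p)) * d p + μ * Complex.sinh (μ * (x - p)) * c p := by
  have h1 := h.add_eq_exp hx hp
  have h2 := h.neg.add_eq_exp hx hp
  rw [← Complex.cosh_add_sinh] at h1
  rw [neg_mul μ (x - p : ℂ), ← Complex.cosh_sub_sinh] at h2
  linear_combination (1 / 2 : ℂ) * h1 + (1 / 2 : ℂ) * h2

lemma mul_eq (h : IsSolution μ f c d) {x p : ℝ} (hx : x ∈ Icc a b) (hp : p ∈ Icc a b) :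
    μ * c x = Complex.sinh (μ * (x - p)) * d p + μ * Complex.cosh (μ * (x - p)) * c p := by
  have h1 := h.add_eq_exp hx hp
  have h2 := h.neg.add_eq_exp hx hp
  rw [← Complex.cosh_add_sinh] at h1
  rw [neg_mul μ (x - p : ℂ), ← Complex.cosh_sub_sinh] at h2
  linear_combination (1 / 2 : ℂ) * h1 - (1 / 2 : ℂ) * h2

/-- A solution with vanishing initial data is zero. -/
lemma eq_zero (h : IsSolution μ f c d) (hμ : μ ≠ 0) {p : ℝ} (hp : p ∈ Icc a b) (hc : c p = 0)
    (hd : d p = 0) : f = 0 := by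
  refine Lp.ext ?_
  filter_upwards [h.ae_eq, ae_restrict_mem measurableSet_Ioo,
    Lp.coeFn_zero ℂ 2 (volume.restrict (Ioo a b))] with x h1 h2 h3
  have := h.mul_eq (Ioo_subset_Icc_self h2) hp
  rw [hc, hd, mul_zero, mul_zero, add_zero] at this
  rw [h1, h3, Pi.zero_apply]
  exact (mul_eq_zero.1 this).resolve_left hμ

lemma eq_of_hasValue (h : IsSolution μ f c d) (hab : a < b) {p : ℝ} (hp : p ∈ Icc a b) {ζ : ℂ}
    (hv : HasValue f p ζ) : c p = ζ := hv.eq_of_ae hab hp h.continuousOn h.ae_eq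

lemma eq_of_hasValue_smul (h : IsSolution μ f c d) (hab : a < b) {p : ℝ} (hp : p ∈ Icc a b)
    {k ζ : ℂ} (hv : HasValue (k • f) p ζ) : k * c p = ζ :=
  hv.eq_of_ae hab hp (continuousOn_const.mul h.continuousOn) (ae_eq_smul k h.ae_eq)

lemma eq_of_hasValue_wd (h : IsSolution μ f c d) (hab : a < b) {p : ℝ} (hp : p ∈ Icc a b) {ζ : ℂ}
    (hv : HasValue (wd f) p ζ) : d p = ζ := hv.eq_of_ae hab hp h.continuousOn' h.ae_eq_wd

end IsSolution

/-! Eigenvalues and the determinant -/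

lemma csqrt_ne_zero {z : ℂ} (hz : z ≠ 0) : csqrt z ≠ 0 := fun h0 => hz (by
  rw [← csqrt_sq z, h0, zero_pow two_ne_zero])

/-- For `u = q₀ sinh(z x)`, `w = q₁ cosh(√z (x-1)) + q₂ sinh(√z (x-1))` and `ũ = q₃ sinh(z (3-x))`,
the four rows are `v(1) = w(1)`, `u'(1) = w'(1)`, `ṽ(2) = w(2)` and `ũ'(2) = w'(2)`. -/
lemma M_mulVec_eq_zero_iff (z : ℂ) (q : Fin 4 → ℂ) : (M z).mulVec q = 0 ↔
    z * Complex.sinh z * q 0 = q 1 ∧ z * Complex.cosh z * q 0 = csqrt z * q 2 ∧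
    Complex.cosh (csqrt z) * q 1 + Complex.sinh (csqrt z) * q 2 = z * Complex.sinh z * q 3 ∧
    csqrt z * Complex.sinh (csqrt z) * q 1 + csqrt z * Complex.cosh (csqrt z) * q 2
      = -(z * Complex.cosh z * q 3) := by
  rw [funext_iff]
  simp only [Fin.forall_fin_succ, IsEmpty.forall_iff, and_true, M, Matrix.mulVec, dotProduct,
    Fin.sum_univ_four, Pi.zero_apply]
  simp
  refine and_congr ?_ (and_congr ?_ (and_congr ?_ ?_))
  · constructor <;> intro h <;> linear_combination h
  · constructor <;> intro h <;> linear_combination h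
  · constructor <;> intro h <;> linear_combination -h
  · constructor <;> intro h <;> linear_combination h

lemma det_M_eq_zero_of_isEigenvalue {z : ℂ} (hz : z ≠ 0) (h : IsEigenvalue A z) :
    (M z).det = 0 := by
  obtain ⟨⟨x, hx⟩, hx0, hAx⟩ := h
  replace hx : InDomain x := hx
  replace hAx : act x hx = z • x := hAx
  replace hx0 : x ≠ 0 := hx0
  have hs := csqrt_ne_zero hz
  have hv : x.v = z • x.u := by rw [← act_u x hx, hAx, X.smul_u]
  have hvt : x.vt = z • x.ut := by rw [← act_ut x hx, hAx, X.smul_ut]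
  have hu2 : wd (wd x.u) = z ^ 2 • x.u := by
    rw [← act_v x hx, hAx, X.smul_v, hv, smul_smul, sq]
  have hut2 : wd (wd x.ut) = z ^ 2 • x.ut := by
    rw [← act_vt x hx, hAx, X.smul_vt, hvt, smul_smul, sq]
  have hw2 : wd (wd x.w) = csqrt z ^ 2 • x.w := by
    rw [← act_w x hx, hAx, X.smul_w, csqrt_sq]
  obtain ⟨c, d, hu⟩ := exists_isSolution one_pos hx.u_mem hu2
  obtain ⟨e, f, hw⟩ := exists_isSolution (by norm_num) hx.w_mem hw2
  obtain ⟨c', d', hut⟩ := exists_isSolution (by norm_num) hx.ut_mem hut2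
  have c0 : c 0 = 0 := hu.eq_of_hasValue one_pos (by norm_num) x.u_zero
  have c3 : c' 3 = 0 := hut.eq_of_hasValue (by norm_num) (by norm_num) x.ut_three
  have v1 : z * c 1 = e 1 := by
    obtain ⟨ζ, h1, h2⟩ := hx.value_one
    rw [hv] at h1
    rw [hu.eq_of_hasValue_smul one_pos (by norm_num) h1,
      hw.eq_of_hasValue (by norm_num) (by norm_num) h2]
  have v2 : z * c' 2 = e 2 := by
    obtain ⟨ζ, h1, h2⟩ := hx.value_two
    rw [hvt] at h1
    rw [hut.eq_of_hasValue_smul (by norm_num) (by norm_num) h1,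
      hw.eq_of_hasValue (by norm_num) (by norm_num) h2]
  have f1 : d 1 = f 1 := by
    obtain ⟨ζ, h1, h2⟩ := hx.flux_one
    rw [hu.eq_of_hasValue_wd one_pos (by norm_num) h1,
      hw.eq_of_hasValue_wd (by norm_num) (by norm_num) h2]
  have f2 : d' 2 = f 2 := by
    obtain ⟨ζ, h1, h2⟩ := hx.flux_two
    rw [hut.eq_of_hasValue_wd (by norm_num) (by norm_num) h1,
      hw.eq_of_hasValue_wd (by norm_num) (by norm_num) h2]
  -- The outer waves are expanded from 0 and 3, where `u` and `ũ` vanish, and the heat component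
  -- from 1.
  have u1 := hu.deriv_eq (x := 1) (p := 0) (by norm_num) (by norm_num)
  have u2 := hu.mul_eq (x := 1) (p := 0) (by norm_num) (by norm_num)
  have w1 := hw.deriv_eq (x := 2) (p := 1) (by norm_num) (by norm_num)
  have w2 := hw.mul_eq (x := 2) (p := 1) (by norm_num) (by norm_num)
  have t1 := hut.deriv_eq (x := 2) (p := 3) (by norm_num) (by norm_num)
  have t2 := hut.mul_eq (x := 2) (p := 3) (by norm_num) (by norm_num)
  have k1 : ((1 : ℝ) : ℂ) - (0 : ℝ) = 1 := by norm_num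
  have k2 : ((2 : ℝ) : ℂ) - (1 : ℝ) = 1 := by norm_num
  have k3 : ((2 : ℝ) : ℂ) - (3 : ℝ) = -1 := by norm_num
  rw [k1, mul_one, c0] at u1 u2
  rw [k2, mul_one] at w1 w2
  rw [k3, mul_neg_one, Complex.cosh_neg, Complex.sinh_neg, c3] at t1 t2
  -- The entries are the coefficients in the basis of `sinh` and `cosh`, read off from the initial
  -- data at 0, 1 and 3; the sign of the last reflects `ũ = q₃ sinh(z (3-x))`. If all vanish, so
  -- does the eigenvector.
  refine Matrix.exists_mulVec_eq_zero_iff.1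
    ⟨![d 0 / z, e 1, f 1 / csqrt z, -d' 3 / z], fun hq => hx0 ?_, ?_⟩
  · have q0 : d 0 / z = 0 := congrFun hq 0
    have q1 : e 1 = 0 := congrFun hq 1
    have q2 : f 1 / csqrt z = 0 := congrFun hq 2
    have q3 : -d' 3 / z = 0 := congrFun hq 3
    have d0 : d 0 = 0 := (div_eq_zero_iff.1 q0).resolve_right hz
    have f10 : f 1 = 0 := (div_eq_zero_iff.1 q2).resolve_right hs
    have d30 : d' 3 = 0 := neg_eq_zero.1 ((div_eq_zero_iff.1 q3).resolve_right hz)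
    have zu : x.u = 0 := hu.eq_zero hz (by norm_num) c0 d0
    have zw : x.w = 0 := hw.eq_zero hs (by norm_num) q1 f10
    have zut : x.ut = 0 := hut.eq_zero hz (by norm_num) c3 d30
    exact X.ext zu (by rw [hv, zu, smul_zero, X.zero_v]) zw zut
      (by rw [hvt, zut, smul_zero, X.zero_vt])
  · rw [M_mulVec_eq_zero_iff]
    simp only [Matrix.cons_val]
    refine ⟨?_, ?_, ?_, ?_⟩
    · field_simp
      linear_combination v1 - u2
    · field_simp
      linear_combination f1 - u1
    · field_simp
      linear_combination csqrt z * (t2 - v2) - w2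
    · field_simp
      linear_combination t1 - f2 - w1

lemma isEigenvalue_of_det_M_eq_zero {z : ℂ} (hz : z ≠ 0) (h : (M z).det = 0) :
    IsEigenvalue A z := by
  obtain ⟨q, hq0, hq⟩ := Matrix.exists_mulVec_eq_zero_iff.2 h
  obtain ⟨r0, r1, r2, r3⟩ := (M_mulVec_eq_zero_iff z q).1 hq
  have hs := csqrt_ne_zero hz
  have i1 : (0 : ℝ) ≤ 1 := by norm_num
  have i2 : (1 : ℝ) ≤ 2 := by norm_num
  have i3 : (2 : ℝ) ≤ 3 := by norm_num
  set x : X := X.mk (hyp 0 1 z 0 0 (q 0)) (z • hyp 0 1 z 0 0 (q 0)) (hyp 1 2 (csqrt z) 1 (q 1) (q 2))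
    (hyp 2 3 z 3 0 (-q 3)) (z • hyp 2 3 z 3 0 (-q 3)) (hyp_mem_H1 i1) (hyp_mem_H1 i3)
    hasValue_hyp_self hasValue_hyp_self
  have hu : x.u = hyp 0 1 z 0 0 (q 0) := rfl
  have hv : x.v = z • hyp 0 1 z 0 0 (q 0) := rfl
  have hw : x.w = hyp 1 2 (csqrt z) 1 (q 1) (q 2) := rfl
  have hut : x.ut = hyp 2 3 z 3 0 (-q 3) := rfl
  have hvt : x.vt = z • hyp 2 3 z 3 0 (-q 3) := rfl
  clear_value x
  have k1 : ((1 : ℝ) : ℂ) - (0 : ℝ) = 1 := by norm_num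
  have k2 : ((2 : ℝ) : ℂ) - (1 : ℝ) = 1 := by norm_num
  have k3 : ((2 : ℝ) : ℂ) - (3 : ℝ) = -1 := by norm_num
  have hx : InDomain x :=
    { u_mem := by rw [hu]; exact hyp_mem_H2 i1
      v_mem := by rw [hv]; exact Submodule.smul_mem _ _ (hyp_mem_H1 i1)
      w_mem := by rw [hw]; exact hyp_mem_H2 i2
      ut_mem := by rw [hut]; exact hyp_mem_H2 i3
      vt_mem := by rw [hvt]; exact Submodule.smul_mem _ _ (hyp_mem_H1 i3)
      v_zero := by rw [hv]; exact hasValue_hyp_self.smul_zero z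
      vt_three := by rw [hvt]; exact hasValue_hyp_self.smul_zero z
      flux_one := by
        refine ⟨csqrt z * q 2, ?_, ?_⟩
        · rw [hu, wd_hyp i1]
          convert hasValue_hyp (a := 0) (b := 1) 1 using 1
          rw [k1, mul_one, ← r1]
          ring
        · rw [hw, wd_hyp i2]
          exact hasValue_hyp_self
      value_one := by
        refine ⟨q 1, ?_, ?_⟩
        · rw [hv, smul_hyp]
          convert hasValue_hyp (a := 0) (b := 1) 1 using 1
          rw [k1, mul_one, ← r0]
          ring
        · rw [hw]
          exact hasValue_hyp_self
      flux_two := by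
        refine ⟨-(z * Complex.cosh z * q 3), ?_, ?_⟩
        · rw [hut, wd_hyp i3]
          convert hasValue_hyp (a := 2) (b := 3) 2 using 1
          rw [k3, mul_neg_one, Complex.cosh_neg, Complex.sinh_neg]
          ring
        · rw [hw, wd_hyp i2]
          convert hasValue_hyp (a := 1) (b := 2) 2 using 1
          rw [k2, mul_one, ← r3]
          ring
      value_two := by
        refine ⟨z * Complex.sinh z * q 3, ?_, ?_⟩
        · rw [hvt, smul_hyp]
          convert hasValue_hyp (a := 2) (b := 3) 2 using 1
          rw [k3, mul_neg_one, Complex.cosh_neg, Complex.sinh_neg]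
          ring
        · rw [hw]
          convert hasValue_hyp (a := 1) (b := 2) 2 using 1
          rw [k2, mul_one, ← r2]
          ring }
  refine ⟨⟨x, hx⟩, fun h0 => hq0 ?_, ?_⟩
  · replace h0 : x = 0 := h0
    -- Each coefficient is recovered, up to a nonzero factor, from the value of `u'` at 0, of `w` or
    -- `w'` at 1, or of `ũ'` at 3.
    have du : HasValue (wd x.u) 0 (z * q 0) := by
      rw [hu, wd_hyp i1]
      exact hasValue_hyp_self
    have dut : HasValue (wd x.ut) 3 (z * -q 3) := by
      rw [hut, wd_hyp i3]
      exact hasValue_hyp_self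
    have dw : HasValue (wd x.w) 1 (csqrt z * q 2) := by
      rw [hw, wd_hyp i2]
      exact hasValue_hyp_self
    have w1 : HasValue x.w 1 (q 1) := by
      rw [hw]
      exact hasValue_hyp_self
    rw [h0, X.zero_u, wd_zero] at du
    rw [h0, X.zero_ut, wd_zero] at dut
    rw [h0, X.zero_w, wd_zero] at dw
    rw [h0, X.zero_w] at w1
    have q0 := du.unique (by norm_num) (by norm_num) HasValue.zero
    have q1 := w1.unique (by norm_num) (by norm_num) HasValue.zero
    have q2 := dw.unique (by norm_num) (by norm_num) HasValue.zero
    have q3 := dut.unique (by norm_num) (by norm_num) HasValue.zero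
    funext i
    fin_cases i
    · exact (mul_eq_zero.1 q0).resolve_left hz
    · exact q1
    · exact (mul_eq_zero.1 q2).resolve_left hs
    · exact neg_eq_zero.1 ((mul_eq_zero.1 q3).resolve_left hz)
  · change act x hx = z • x
    refine X.ext ?_ ?_ ?_ ?_ ?_
    · rw [act_u, X.smul_u, hv, hu]
    · rw [act_v, X.smul_v, hv, hu, wd_wd_hyp i1, smul_smul, sq]
    · rw [act_w, X.smul_w, hw, wd_wd_hyp i2, csqrt_sq]
    · rw [act_ut, X.smul_ut, hvt, hut]
    · rw [act_vt, X.smul_vt, hvt, hut, wd_wd_hyp i3, smul_smul, sq]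

/-- The point 0 needs separate care: `det M_0 = 0`, yet 0 lies in the resolvent set. -/
lemma mem_spec_A_iff_det (z : ℂ) : z ∈ spec A ↔ z.re < 0 ∧ (M z).det = 0 := by
  constructor
  · intro hz
    have hz0 : z ≠ 0 := by
      rintro rfl
      exact zero_notMem_spec_A hz
    have hdet := det_M_eq_zero_of_isEigenvalue hz0 ((mem_spec_A_iff z).1 hz)
    exact ⟨by_contra fun h => det_M_ne_zero hz0 (not_lt.1 h) hdet, hdet⟩
  · rintro ⟨hre, hdet⟩
    refine (mem_spec_A_iff z).2 (isEigenvalue_of_det_M_eq_zero ?_ hdet)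
    rintro rfl
    exact lt_irrefl _ hre

end WaveHeatWave

end

theorem theorem2p3 :
    (∀ z ∈ WaveHeatWave.spec WaveHeatWave.A,
      WaveHeatWave.IsEigenvalue WaveHeatWave.A z ∧
        ∃ ε > 0, ∀ z' ∈ WaveHeatWave.spec WaveHeatWave.A, dist z' z < ε → z' = z) ∧
    WaveHeatWave.spec WaveHeatWave.A = {z : ℂ | z.re < 0 ∧ (WaveHeatWave.M z).det = 0} ∧
    WaveHeatWave.spec WaveHeatWave.A ∩ {z : ℂ | z.re = 0} = ∅ := by
  refine ⟨fun z hz => ⟨(WaveHeatWave.mem_spec_A_iff z).1 hz, ?_⟩,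
    Set.ext fun z => WaveHeatWave.mem_spec_A_iff_det z, ?_⟩
  · obtain ⟨ε, hε, h⟩ := WaveHeatWave.exists_isolating_det_M z
    refine ⟨ε, hε, fun z' hz' => h z' ?_ ((WaveHeatWave.mem_spec_A_iff_det z').1 hz').2⟩
    rintro rfl
    exact WaveHeatWave.zero_notMem_spec_A hz'
  · refine Set.eq_empty_of_forall_notMem fun z ⟨hz, hre⟩ => ?_
    exact ((WaveHeatWave.mem_spec_A_iff_det z).1 hz).1.ne hre
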